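/- **Setting.** Let $\mathcal G$ be a connected undirected graph on agents $1,\dots,N$ (with at least two agents), with degrees $d_i=|\mathcal N_i|$, adjacency matrix $A$ and Laplacian $\mathcal L$, and let $\lambda_u$ and $\lambda_l$ be the largest and the smallest nonzero eigenvalue of $\mathcal L$. Agent $i$ has $m_i$ differentiable losses $f_{i,h}:\mathbb R^n\to\mathbb R$; put $f_i=\frac1{m_i}\sum_h f_{i,h}$ and $F=\frac1N\sum_i f_i$, and let $x^*$ be a minimizer of $F$. Assume $\nabla f_i$ is $L$-Lipschitz ($L>0$) for every $i$; $\|\nabla F(x)-\nabla f_i(x)\|\le\sigma_f$ for all $i,x$; and, for a batch $\mathcal B$ drawn uniformly without replacement from the data of agent $i$, of size $1\le|\mathcal B|=q_i<m_i$, the gradient $g_i(x;\mathcal B)=\frac1{|\mathcal B|}\sum_{h\in\mathcal B}\nabla f_{i,h}(x)$ satisfies $\mathbb E[g_i(x;\mathcal B)-\nabla f_i(x)]=0$ and $\mathbb E\|g_i(x;\mathcal B)-\nabla f_i(x)\|\le\sigma_g$ for all $x$. Here $\sigma_f,\sigma_g>0$. **Algorithm LT-ADMM-DP.** Parameters: $\rho,\beta,\gamma,\zeta,\sigma_e>0$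 and an integer $\tau\ge1$. Given deterministic $x_{i,0}$, and $z_{ij,0}$ for $j\in\mathcal N_i$, with $\sum_i\sum_{j\in\mathcal N_i}z_{ij,0}=\rho\sum_i d_i x_{i,0}$, round $k=0,1,\dots$ is $$\phi^0_{i,k}=x_{i,k},\qquad \phi^{t+1}_{i,k}=\phi^t_{i,k}-\gamma\Big(\frac{\zeta}{\zeta+\|g^t_{i,k}\|}g^t_{i,k}+e^t_{i,k}\Big)-\beta\Big(\rho d_i x_{i,k}-\sum_{j\in\mathcal N_i}z_{ij,k}\Big)\quad(0\le t<\tau),$$ $$x_{i,k+1}=\phi^\tau_{i,k},\qquad z_{ij,k+1}=\tfrac12 z_{ij,k}-\tfrac12\big(z_{ji,k}-2\rho x_{j,k+1}\big),$$ where $g^t_{i,k}=g_i(\phi^t_{i,k};\mathcal B^t_{i,k})$, the batches $\mathcal B^t_{i,k}$ are uniform of size $q_i$, $e^t_{i,k}\sim\mathcal N(0,\sigma_e^2I_n)$, and all batches and noises are mutually independent. Put $\bar x_k=\frac1N\sum_i x_{i,k}$. **The constant $\|\hat d_0\|$.** Let $X_0$ be the $N\times n$ matrix with rows $x_{i,0}$,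 and let $Y_0$ and $\tilde Y_0$ have rows $\sum_{j\in\mathcal N_i}z_{ij,0}-\frac\gamma\beta\nabla f_i(\bar x_0)-\rho d_i x_{i,0}$ and $\sum_{j\in\mathcal N_i}z_{ji,0}+\frac\gamma\beta\nabla f_i(\bar x_0)-\rho d_i x_{i,0}$. Let the columns of $\hat Q\in\mathbb R^{N\times(N-1)}$ be orthonormal eigenvectors of $\mathcal L$ for its nonzero eigenvalues $\lambda_1,\dots,\lambda_{N-1}$. Let $\hat V$ be the block-diagonal matrix of eigenvectors with, for each $j$, a $3\times3$ block whose columns are eigenvectors of $$\begin{pmatrix}1&\beta\tau&0\\-\rho\lambda_j&\frac12-\rho\lambda_j\beta\tau&-\frac12\\0&-\frac12&\frac12\end{pmatrix},$$ (three distinct eigenvalues under the condition on $\beta$ below), scaled so that all entries of its last two rows have modulus $1$. Then $\hat d_0=\hat V^{-1}[\hat Q^TX_0;\hat Q^TY_0;\hat Q^T\tilde Y_0]$, and $\|\hat d_0\|$ is its Frobenius norm (it does not depend on the choices). **Theorem.** Let $\zeta>8\sigma_g$ and $\beta<\frac{2}{\tau\lambda_u\rho}$. For $C>0$ consider the estimate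 $$\frac1K\sum_{k=0}^{K-1}\mathbb E\Big[\big(\tfrac\zeta4-2\sigma_g\big)\|\nabla F(\bar x_k)\|\,\mathbf 1_{\{\|\nabla F(\bar x_k)\|\ge\zeta\}}+\tfrac14\|\nabla F(\bar x_k)\|^2\,\mathbf 1_{\{\|\nabla F(\bar x_k)\|<\zeta\}}\Big]$$ $$\le C\,\frac{F(\bar x_0)-F(x^*)}{K\gamma\tau}+C\,\gamma\tau(\zeta^2+\sigma_e^2)+C\,(\sigma_f^2+\zeta\sigma_g)+C\,\frac{\|\hat d_0\|^2}{\rho^2KN}\qquad(\ast)$$ (the random variables on the left being integrable). 1. For every $c>0$ there is a $C>0$, depending only on $c,n,L,\lambda_l,\lambda_u$ and the product $\beta\tau\rho$, such that $(\ast)$ holds for all $K\ge1$ whenever $\gamma\le c\,\frac{\lambda_l}{L\tau^2}$. 2. There is a $C>0$, depending only on $n,L,\lambda_l,\lambda_u,\beta,\rho$, such that $(\ast)$ holds for all $K\ge1$ whenever $$\frac14+\frac{8L^2}{N}\gamma^2s_1+\frac{8L^2}{N}s_0\frac{c_1\gamma^2}{(1-\kappa)^2}\le\frac12,$$ where $s_0=\frac{54\beta}{\lambda_l\rho}+108\tau\beta^2$,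 $s_1=12\tau N+24N$, $\kappa=1-\frac{\lambda_l\rho\tau\beta}{2}$ and $c_1=(1+2\rho^2\|\mathcal L\|^2)\,4\tau^2N\,\|\hat V^{-1}\|$ (spectral norms). -/

import Mathlib

open MeasureTheory ProbabilityTheory
open scoped Classical

noncomputable section

/-- The parameter space `ℝⁿ` with its Euclidean norm. -/
abbrev Vec (n : ℕ) : Type := EuclideanSpace ℝ (Fin n)

/-- The data of one run of LT-ADMM-DP: the network of `N` agents, the local data sets with their
losses, the batch sizes, the parameters of the algorithm and the initial values. -/
structure LTADMMDP (n : ℕ) where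
  /-- number of agents -/
  N : ℕ
  /-- the communication graph -/
  G : SimpleGraph (Fin N)
  /-- number of data points of each agent -/
  m : Fin N → ℕ
  /-- loss of agent `i` at its data point `h` -/
  loss : (i : Fin N) → Fin (m i) → Vec n → ℝ
  /-- mini-batch size of each agent -/
  q : Fin N → ℕ
  /-- penalty parameter -/
  ρ : ℝ
  /-- step size of the consensus correction -/
  β : ℝ
  /-- step size of the gradient steps -/
  γ : ℝ
  /-- clipping threshold -/
  ζ : ℝ
  /-- standard deviation of the privacy noise -/
  σe : ℝ
  /-- number of local training steps -/
  τ : ℕ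
  /-- initial models -/
  x0 : Fin N → Vec n
  /-- initial bridge variables, `z0 i j` being used for neighbours `i`, `j` only -/
  z0 : Fin N → Fin N → Vec n

namespace LTADMMDP

variable {n : ℕ} (S : LTADMMDP n)

/-! ### Costs -/

/-- Local cost `f i`, the average of the losses of agent `i`. -/
def f (i : Fin S.N) (x : Vec n) : ℝ := (S.m i : ℝ)⁻¹ * ∑ h, S.loss i h x

/-- Global cost, the average of the local costs. -/
def F (x : Vec n) : ℝ := (S.N : ℝ)⁻¹ * ∑ i, S.f i x

/-- Average of a family of vectors indexed by the agents. -/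
def mean (x : Fin S.N → Vec n) : Vec n := (S.N : ℝ)⁻¹ • ∑ i, x i

/-- Mini-batch gradient of agent `i` on the batch `B`, at the point `φ`. -/
def batchGrad (i : Fin S.N) (B : Finset (Fin (S.m i))) (φ : Vec n) : Vec n :=
  (B.card : ℝ)⁻¹ • ∑ h ∈ B, gradient (S.loss i h) φ

/-- The batches that agent `i` may draw: all sets of `q i` data points. -/
def batches (i : Fin S.N) : Finset (Finset (Fin (S.m i))) :=
  Finset.powersetCard (S.q i) Finset.univ

/-! ### The algorithm -/

/-- Smooth clipping with threshold `ζ`. -/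
def clip (g : Vec n) : Vec n := (S.ζ / (S.ζ + ‖g‖)) • g

/-- Local training started at the models `x` with bridge variables `z`; `B t i` and `e t i` are the
batch and the noise of agent `i` at local step `t`. -/
def localTrain (x : Fin S.N → Vec n) (z : Fin S.N → Fin S.N → Vec n)
    (B : ℕ → (i : Fin S.N) → Finset (Fin (S.m i))) (e : ℕ → Fin S.N → Vec n) :
    ℕ → Fin S.N → Vec n
  | 0 => x
  | t + 1 => fun i =>
      localTrain x z B e t i -
        (S.γ • (S.clip (S.batchGrad i (B t i) (localTrain x z B e t i)) + e t i) +
          S.β • ((S.ρ * (S.G.degree i : ℝ)) • x i - ∑ j ∈ S.G.neighborFinset i, z i j))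

/-- Models and bridge variables after `k` rounds; `B k t i` and `e k t i` are the batch and the
noise of agent `i` at local step `t` of round `k`. -/
def state (B : ℕ → ℕ → (i : Fin S.N) → Finset (Fin (S.m i))) (e : ℕ → ℕ → Fin S.N → Vec n) :
    ℕ → (Fin S.N → Vec n) × (Fin S.N → Fin S.N → Vec n)
  | 0 => (S.x0, S.z0)
  | k + 1 =>
      let x' := S.localTrain (state B e k).1 (state B e k).2 (B k) (e k) S.τ
      (x', fun i j => (1 / 2 : ℝ) • (state B e k).2 i j -
        (1 / 2 : ℝ) • ((state B e k).2 j i - (2 * S.ρ) • x' j))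

/-- Average model after `k` rounds. -/
def xbar (B : ℕ → ℕ → (i : Fin S.N) → Finset (Fin (S.m i))) (e : ℕ → ℕ → Fin S.N → Vec n)
    (k : ℕ) : Vec n :=
  S.mean (S.state B e k).1

/-- The randomness of the algorithm: every batch is drawn uniformly without replacement, every noise
vector has law `N(0, σe² I)`, and all these draws (over the rounds `k`, the local steps `t < τ` and
the agents `i`) are mutually independent. -/
structure IsDraw {Ω : Type*} [MeasurableSpace Ω] (P : Measure Ω)
    (B : ℕ → ℕ → (i : Fin S.N) → Ω → Finset (Fin (S.m i)))
    (e : ℕ → ℕ → Fin S.N → Ω → Vec n) : Prop where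
  batch_law : ∀ k, ∀ t < S.τ, ∀ i,
    HasLaw (B k t i) (uniformOn (S.batches i : Set (Finset (Fin (S.m i))))) P
  noise_law : ∀ k, ∀ t < S.τ, ∀ i,
    HasLaw (e k t i) (multivariateGaussian 0 ((S.σe ^ 2) • (1 : Matrix (Fin n) (Fin n) ℝ))) P
  indep_batch_noise : ∀ k, ∀ t < S.τ, ∀ i, IndepFun (B k t i) (e k t i) P
  indep : iIndepFun (fun (p : ℕ × Fin S.τ × Fin S.N) (ω : Ω) =>
    (B p.1 p.2.1 p.2.2 ω, e p.1 p.2.1 p.2.2 ω)) P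

/-! ### The constant `‖d̂₀‖²` -/

/-- Eigenvalues of the graph Laplacian. -/
def lapEig (j : Fin S.N) : ℝ := (S.G.isHermitian_lapMatrix (R := ℝ)).eigenvalues j

/-- Indices of the nonzero Laplacian eigenvalues; there are `N - 1` of them if the graph is
connected. -/
abbrev Mode : Type := {j : Fin S.N // S.lapEig j ≠ 0}

/-- The matrix `Q̂`, whose columns are orthonormal Laplacian eigenvectors for the nonzero
eigenvalues: for a connected graph `Q̂ᵀ Q̂ = I`, `Q̂ Q̂ᵀ = I - 11ᵀ/N` and `Q̂ᵀ 1 = 0`. -/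
def Q : Matrix (Fin S.N) S.Mode ℝ :=
  Matrix.of fun i j => (S.G.isHermitian_lapMatrix (R := ℝ)).eigenvectorBasis j.1 i

end LTADMMDP

/-- Transition matrix of `(X, Y, Ỹ)` in the direction of a Laplacian eigenvector with eigenvalue
`l`, where `s` stands for `β τ`. -/
def modeMatrix (s ρ l : ℝ) : Matrix (Fin 3) (Fin 3) ℂ :=
  !![1, (s : ℂ), 0;
     -((ρ * l : ℝ) : ℂ), -((ρ * l * s : ℝ) : ℂ) + 1 / 2, -(1 / 2);
     0, -(1 / 2), 1 / 2]

/-- The eigenvalue `(2 - a + i √(a (2 - a))) / 2` of `modeMatrix s ρ l`, where `a = s ρ l`. The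
other eigenvalues are its conjugate and `0`. -/
def modeEig (s ρ l : ℝ) : ℂ :=
  ⟨(2 - s * ρ * l) / 2, √(s * ρ * l * (2 - s * ρ * l)) / 2⟩

/-- Eigenvectors of `modeMatrix s ρ l` as columns, for the eigenvalues `0`, `μ`, `conj μ`. They are
scaled so that the entries of the second and third rows have modulus one; those of the first row then
have modulus `s`, `√(2 s / (ρ l))`, `√(2 s / (ρ l))`. -/
def modeV (s ρ l : ℝ) : Matrix (Fin 3) (Fin 3) ℂ :=
  let μ := modeEig s ρ l
  let μ' := (starRingEnd ℂ) μ
  let w : ℂ := ((√(2 / (s * ρ * l)) : ℝ) : ℂ)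
  !![-(s : ℂ), w * s, w * s;
     1, w * (μ - 1), w * (μ' - 1);
     1, w * ((μ - 1) * (1 - 2 * μ')), w * ((μ' - 1) * (1 - 2 * μ))]

theorem modeEig_add_conj (s ρ l : ℝ) :
    modeEig s ρ l + (starRingEnd ℂ) (modeEig s ρ l) = 2 - (s : ℂ) * ρ * l := by
  apply Complex.ext <;> simp [modeEig]

theorem modeEig_mul_conj {s ρ l : ℝ} (h0 : 0 < s * ρ * l) (h2 : s * ρ * l < 2) :
    modeEig s ρ l * (starRingEnd ℂ) (modeEig s ρ l) = 1 - (s : ℂ) * ρ * l / 2 := by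
  have h : √(s * ρ * l * (2 - s * ρ * l)) ^ 2 = s * ρ * l * (2 - s * ρ * l) :=
    Real.sq_sqrt (mul_nonneg h0.le (by linarith))
  have e : (1 : ℂ) - (s : ℂ) * ρ * l / 2 = ((1 - s * ρ * l / 2 : ℝ) : ℂ) := by push_cast; ring
  rw [Complex.mul_conj, e, Complex.ofReal_inj, Complex.normSq_apply]
  simp only [modeEig]
  linear_combination h / 4

theorem modeMatrix_mul_modeV {s ρ l : ℝ} (h0 : 0 < s * ρ * l) (h2 : s * ρ * l < 2) :
    modeMatrix s ρ l * modeV s ρ l = modeV s ρ l *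
      Matrix.diagonal ![0, modeEig s ρ l, (starRingEnd ℂ) (modeEig s ρ l)] := by
  have e1 := modeEig_add_conj s ρ l
  have e2 := modeEig_mul_conj h0 h2
  simp only [modeV]
  generalize (starRingEnd ℂ) (modeEig s ρ l) = μ' at *
  generalize modeEig s ρ l = μ at *
  generalize ((√(2 / (s * ρ * l)) : ℝ) : ℂ) = w
  obtain rfl : μ' = 2 - (s : ℂ) * ρ * l - μ := by linear_combination e1
  ext i j
  fin_cases i <;> fin_cases j <;>
    simp [modeMatrix, Matrix.mul_apply, Fin.sum_univ_three]
  · ring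
  · ring
  · linear_combination 2 * w * e2
  · linear_combination 2 * w * e2
  · linear_combination 2 * w * (μ - 1) * e2
  · linear_combination 2 * w * (2 - (s : ℂ) * ρ * l - μ - 1) * e2

theorem det_modeV_ne_zero {s ρ l : ℝ} (h0 : 0 < s * ρ * l) (h2 : s * ρ * l < 2) :
    (modeV s ρ l).det ≠ 0 := by
  have e1 := modeEig_add_conj s ρ l
  have e2 := modeEig_mul_conj h0 h2
  have hs : (s : ℂ) ≠ 0 := by
    rintro h
    have : s = 0 := by exact_mod_cast h
    simp [this] at h0
  have hw : ((√(2 / (s * ρ * l)) : ℝ) : ℂ) ≠ 0 := by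
    rw [Complex.ofReal_ne_zero]; positivity
  have hadd : modeEig s ρ l + (starRingEnd ℂ) (modeEig s ρ l) ≠ 0 := by
    rw [e1]
    intro h
    have : 2 - s * ρ * l = 0 := by exact_mod_cast h
    linarith
  have hsub : modeEig s ρ l - (starRingEnd ℂ) (modeEig s ρ l) ≠ 0 := by
    intro h
    have h' := congrArg Complex.im h
    have hp : 0 < √(s * ρ * l * (2 - s * ρ * l)) :=
      Real.sqrt_pos.mpr (mul_pos h0 (by linarith))
    simp [modeEig] at h'
    linarith
  have hdet : (modeV s ρ l).det = -((√(2 / (s * ρ * l)) : ℝ) : ℂ) ^ 2 * s *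
      ((modeEig s ρ l + (starRingEnd ℂ) (modeEig s ρ l)) *
        (modeEig s ρ l - (starRingEnd ℂ) (modeEig s ρ l))) := by
    have e3 : 2 * (modeEig s ρ l * (starRingEnd ℂ) (modeEig s ρ l)) =
      modeEig s ρ l + (starRingEnd ℂ) (modeEig s ρ l) := by linear_combination 2 * e2 - e1
    simp only [modeV, Matrix.det_fin_three]
    generalize (starRingEnd ℂ) (modeEig s ρ l) = μ' at *
    generalize modeEig s ρ l = μ at *
    generalize ((√(2 / (s * ρ * l)) : ℝ) : ℂ) = w
    simp
    linear_combination w ^ 2 * s * (μ - μ') * e3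
  rw [hdet]
  exact mul_ne_zero (mul_ne_zero (neg_ne_zero.mpr (pow_ne_zero 2 hw)) hs) (mul_ne_zero hadd hsub)

namespace LTADMMDP

variable {n : ℕ} (S : LTADMMDP n)

/-- The matrix `V̂`: block diagonal, one block of eigenvectors for each nonzero Laplacian eigenvalue.
It diagonalizes the transition matrix of `(Q̂ᵀ X, Q̂ᵀ Y, Q̂ᵀ Ỹ)`. -/
def V : Matrix (Fin 3 × S.Mode) (Fin 3 × S.Mode) ℂ :=
  Matrix.blockDiagonal fun j : S.Mode => modeV (S.β * S.τ) S.ρ (S.lapEig j.1)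

/-- `Y₀ = Aᵀ Z₀ - (γ/β) ∇F(X̄₀) - ρ D X₀`. -/
def Y0 (i : Fin S.N) : Vec n :=
  ∑ j ∈ S.G.neighborFinset i, S.z0 i j - (S.γ / S.β) • gradient (S.f i) (S.mean S.x0) -
    (S.ρ * (S.G.degree i : ℝ)) • S.x0 i

/-- `Ỹ₀ = Aᵀ P Z₀ + (γ/β) ∇F(X̄₀) - ρ D X₀`. -/
def Yt0 (i : Fin S.N) : Vec n :=
  ∑ j ∈ S.G.neighborFinset i, S.z0 j i + (S.γ / S.β) • gradient (S.f i) (S.mean S.x0) -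
    (S.ρ * (S.G.degree i : ℝ)) • S.x0 i

/-- `d̂₀ = V̂⁻¹ [Q̂ᵀ X₀; Q̂ᵀ Y₀; Q̂ᵀ Ỹ₀]`, one column for each coordinate of `ℝⁿ`. -/
def d0 : Matrix (Fin 3 × S.Mode) (Fin n) ℂ :=
  S.V⁻¹ * Matrix.of fun p l =>
    ((∑ i, S.Q i p.2 * (![S.x0 i, S.Y0 i, S.Yt0 i] p.1) l : ℝ) : ℂ)

/-- `‖d̂₀‖²`. -/
def d0NormSq : ℝ := ∑ p, ∑ l, ‖S.d0 p l‖ ^ 2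

/-! ### Assumptions and conclusion -/

/-- Standing assumptions. `L` is the smoothness constant, `σf` bounds the gradient variation, `σg` the
deviation of the mini-batch gradients, `lu` and `ll` are the largest and the smallest nonzero
Laplacian eigenvalue, and `xstar` is a minimizer of the global cost. -/
structure Assumptions (L σf σg ll lu : ℝ) (xstar : Vec n) : Prop where
  differentiable : ∀ i h, Differentiable ℝ (S.loss i h)
  smooth : ∀ i x y, ‖gradient (S.f i) x - gradient (S.f i) y‖ ≤ L * ‖x - y‖
  minimizer : ∀ x, S.F xstar ≤ S.F x
  connected : S.G.Connected
  ll_least : IsLeast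
    {l : ℝ | l ≠ 0 ∧ Module.End.HasEigenvalue (Matrix.toLin' (S.G.lapMatrix ℝ)) l} ll
  lu_greatest : IsGreatest
    {l : ℝ | Module.End.HasEigenvalue (Matrix.toLin' (S.G.lapMatrix ℝ)) l} lu
  σf_pos : 0 < σf
  variation : ∀ i x, ‖gradient S.F x - gradient (S.f i) x‖ ≤ σf
  σg_pos : 0 < σg
  batch_size : ∀ i, 1 ≤ S.q i ∧ S.q i < S.m i
  unbiased : ∀ i x, ((S.batches i).card : ℝ)⁻¹ •
    ∑ B ∈ S.batches i, (S.batchGrad i B x - gradient (S.f i) x) = 0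
  deviation : ∀ i x, ((S.batches i).card : ℝ)⁻¹ *
    ∑ B ∈ S.batches i, ‖S.batchGrad i B x - gradient (S.f i) x‖ ≤ σg
  ρ_pos : 0 < S.ρ
  β_pos : 0 < S.β
  γ_pos : 0 < S.γ
  σe_pos : 0 < S.σe
  τ_pos : 1 ≤ S.τ
  /-- the initial bridge variables are balanced: `1ᵀ Aᵀ Z₀ = ρ 1ᵀ D X₀` -/
  init : ∑ i, ∑ j ∈ S.G.neighborFinset i, S.z0 i j = S.ρ • ∑ i, (S.G.degree i : ℝ) • S.x0 i
  ζ_large : 8 * σg < S.ζ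
  β_small : S.β < 2 / (S.τ * lu * S.ρ)

/-- The detailed bound on the step size `γ`, with `s₀`, `s₁`, `c₁` and `κ` spelled out; matrix norms
are spectral norms. -/
def DetailedStepBound (L ll : ℝ) : Prop :=
  let N : ℝ := S.N
  let τ : ℝ := S.τ
  let s₀ : ℝ := 54 * S.β / (ll * S.ρ) + 108 * τ * S.β ^ 2
  let s₁ : ℝ := 12 * τ * N + 24 * N
  let κ : ℝ := 1 - ll * S.ρ * τ * S.β / 2
  let c₁ : ℝ := (1 + 2 * S.ρ ^ 2 * ‖Matrix.toEuclideanCLM (𝕜 := ℝ) (S.G.lapMatrix ℝ)‖ ^ 2) *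
    (4 * τ ^ 2 * N) * ‖Matrix.toEuclideanCLM (𝕜 := ℂ) S.V⁻¹‖
  1 / 4 + 8 * L ^ 2 / N * S.γ ^ 2 * s₁ +
    8 * L ^ 2 / N * s₀ * (c₁ * S.γ ^ 2 / (1 - κ) ^ 2) ≤ 1 / 2

/-- The stationarity measure: `(ζ/4 - 2 σg) ‖∇F(x)‖` if `‖∇F(x)‖ ≥ ζ`, and `‖∇F(x)‖² / 4`
otherwise. -/
def gap (σg : ℝ) (x : Vec n) : ℝ :=
  if S.ζ ≤ ‖gradient S.F x‖ then (S.ζ / 4 - 2 * σg) * ‖gradient S.F x‖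
  else 1 / 4 * ‖gradient S.F x‖ ^ 2

/-- The convergence estimate after `K` rounds, with `C` as the constant of every `O(·)`. -/
def Estimate {Ω : Type*} [MeasurableSpace Ω] (P : Measure Ω)
    (B : ℕ → ℕ → (i : Fin S.N) → Ω → Finset (Fin (S.m i)))
    (e : ℕ → ℕ → Fin S.N → Ω → Vec n) (σf σg : ℝ) (xstar : Vec n) (C : ℝ) (K : ℕ) : Prop :=
  (∀ k < K, Integrable
    (fun ω => S.gap σg (S.xbar (fun k t i => B k t i ω) (fun k t i => e k t i ω) k)) P) ∧
  1 / (K : ℝ) * ∑ k ∈ Finset.range K,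
      ∫ ω, S.gap σg (S.xbar (fun k t i => B k t i ω) (fun k t i => e k t i ω) k) ∂P ≤
    C * ((S.F (S.mean S.x0) - S.F xstar) / (K * S.γ * S.τ)) +
    C * (S.γ * S.τ * (S.ζ ^ 2 + S.σe ^ 2)) +
    C * (σf ^ 2 + S.ζ * σg) +
    C * (S.d0NormSq / (S.ρ ^ 2 * K * S.N))

end LTADMMDP

end

/-! Clipping makes every local gradient step bounded by `ζ`, so the consensus error can be estimated
without knowing anything about the gradients. This breaks the usual feedback between consensus and
optimality. The only information on the step size that is then needed is an upper bound for `γ τ`,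
and it enters only the size of the constant.

Consensus. In the direction of a Laplacian eigenvector with eigenvalue `λ`, the triple `(X, βτ Y, βτ
Ỹ)` obeys a linear recursion governed by `a = βτρλ ∈ (0, 2)` and driven by `γ` times the accumulated
clipped gradients and noise. One direction of the recursion is annihilated in a single step. On the
remaining plane the map is a rotation times `√(1 - a/2)` for an explicit quadratic form
(`modeEnergy_step`). Summing over rounds and modes bounds the total consensus error by the initial
error plus the total squared input (`sum_mode_le`, `sum_consensusErr_le`). The initial error is read
off from `d̂₀` through `V̂` (`sum_norm_sq_hat_init_le`).

Descent. The consensus corrections sum to zero over the agents (`sum_outY`), so the average model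
moves only by the averaged drift. Smooth clipping is bounded and 2-Lipschitz, and the clip of a
vector near `∇F` correlates with `∇F` by at least the stationarity measure, up to a squared error
(`inner_clip_self_add`). The descent inequality for `F` then gives a pathwise bound that telescopes
(`F_xbar_succ_le`, `sum_gap_le`).

Expectation. A fresh batch is independent of the past, so its error costs at most `2σg ‖∇F‖` on
average. Exactly this amount is kept in reserve on the left side, which is why the measure has the
factor `ζ/4 - 2σg`. The noise has mean zero and contributes only through its variance
(`sum_integral_gap_le`).

Uniformity. The resulting `rateConst` depends on the algorithm only through `βτρ` and the bound on
`γτ`. In the second part `τ < 2/(λ_u ρ β)` leaves finitely many values of `βτρ`. -/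

noncomputable section

namespace LTADMMDP

section

/-! ### Averages, gradients and smoothness -/

section Smooth

variable {E : Type*} [NormedAddCommGroup E]

theorem norm_sum_sq_le {ι : Type*} (s : Finset ι) (v : ι → E) :
    ‖∑ i ∈ s, v i‖ ^ 2 ≤ s.card * ∑ i ∈ s, ‖v i‖ ^ 2 :=
  (pow_le_pow_left₀ (norm_nonneg _) (norm_sum_le s v) 2).trans sq_sum_le_card_mul_sum_sq

theorem norm_add_sq_le (x y : E) : ‖x + y‖ ^ 2 ≤ 2 * ‖x‖ ^ 2 + 2 * ‖y‖ ^ 2 := by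
  nlinarith [norm_nonneg (x + y), norm_add_le x y, sq_nonneg (‖x‖ - ‖y‖)]

theorem norm_sub_sq_le (x y : E) : ‖x - y‖ ^ 2 ≤ 2 * ‖x‖ ^ 2 + 2 * ‖y‖ ^ 2 := by
  nlinarith [norm_nonneg (x - y), norm_sub_le x y, sq_nonneg (‖x‖ - ‖y‖)]

theorem norm_add_three_sq_le (x y z : E) :
    ‖x + y + z‖ ^ 2 ≤ 3 * (‖x‖ ^ 2 + ‖y‖ ^ 2 + ‖z‖ ^ 2) := by
  have := norm_add₃_le (a := x) (b := y) (c := z)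
  nlinarith [norm_nonneg (x + y + z), sq_nonneg (‖x‖ - ‖y‖), sq_nonneg (‖x‖ - ‖z‖),
    sq_nonneg (‖y‖ - ‖z‖)]

variable [InnerProductSpace ℝ E] [CompleteSpace E]

theorem hasGradientAt_const_mul_sum {ι : Type*} (s : Finset ι) (c : ℝ) {f : ι → E → ℝ}
    {g : ι → E} {x : E} (h : ∀ i ∈ s, HasGradientAt (f i) (g i) x) :
    HasGradientAt (fun y => c * ∑ i ∈ s, f i y) (c • ∑ i ∈ s, g i) x := by
  rw [hasGradientAt_iff_hasFDerivAt, map_smul, map_sum]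
  have := HasFDerivAt.fun_sum (u := s) (fun i hi => (h i hi).hasFDerivAt)
  exact this.const_mul c

/-- The mean value theorem supplies a point `z` on the segment, where the gradient differs from the
one at `x` by at most `L ‖y - x‖`. This costs `L` in place of the sharp `L / 2`, which is immaterial
for the rate. -/
theorem le_add_inner_gradient_add {F : E → ℝ} {L : ℝ} (hF : Differentiable ℝ F)
    (hL : ∀ x y, ‖gradient F x - gradient F y‖ ≤ L * ‖x - y‖) (hL0 : 0 ≤ L) (x y : E) :
    F y ≤ F x + inner ℝ (gradient F x) (y - x) + L * ‖y - x‖ ^ 2 := by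
  obtain ⟨z, hz, hzeq⟩ := domain_mvt (f := F) (s := Set.univ)
    (f' := fun z => InnerProductSpace.toDual ℝ E (gradient F z))
    (fun z _ => ((hF z).hasGradientAt.hasFDerivAt).hasFDerivWithinAt) convex_univ
    (Set.mem_univ x) (Set.mem_univ y)
  rw [InnerProductSpace.toDual_apply_apply] at hzeq
  have h1 : inner ℝ (gradient F z) (y - x) = inner ℝ (gradient F x) (y - x) +
      inner ℝ (gradient F z - gradient F x) (y - x) := by
    rw [inner_sub_left]; ring
  have h2 := real_inner_le_norm (gradient F z - gradient F x) (y - x)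
  have h3 : ‖z - x‖ ≤ ‖y - x‖ := by
    rw [← dist_eq_norm, ← dist_eq_norm]
    obtain ⟨a, b, ha, hb, hab, rfl⟩ := hz
    rw [dist_eq_norm, dist_eq_norm]
    have : a • x + b • y - x = b • (y - x) := by
      have : a = 1 - b := by linarith
      subst this
      module
    rw [this, norm_smul, Real.norm_of_nonneg hb]
    exact mul_le_of_le_one_left (norm_nonneg _) (by linarith)
  have h4 : ‖gradient F z - gradient F x‖ * ‖y - x‖ ≤ L * ‖y - x‖ * ‖y - x‖ :=
    mul_le_mul_of_nonneg_right ((hL z x).trans (by gcongr)) (norm_nonneg _)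
  nlinarith

end Smooth

/-! ### Smooth clipping -/

variable {n : ℕ} (S : LTADMMDP n)

theorem norm_clip_le (hζ : 0 < S.ζ) (g : Vec n) : ‖S.clip g‖ ≤ S.ζ := by
  have : 0 < S.ζ + ‖g‖ := by positivity
  rw [clip, norm_smul, Real.norm_of_nonneg (by positivity), div_mul_eq_mul_div, div_le_iff₀ this]
  nlinarith [norm_nonneg g]

theorem norm_clip_sub_le (hζ : 0 < S.ζ) (a b : Vec n) :
    ‖S.clip a - S.clip b‖ ≤ 2 * ‖a - b‖ := by
  have ha : 0 < S.ζ + ‖a‖ := by positivity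
  have hb : 0 < S.ζ + ‖b‖ := by positivity
  -- Each of the two summands contributes one `‖a - b‖`: the scalar factor of the first is at most
  -- one, and in the second the difference of the factors carries a denominator `ζ + ‖b‖` that
  -- absorbs `‖b‖`.
  have e : S.clip a - S.clip b = (S.ζ / (S.ζ + ‖a‖)) • (a - b) +
      (S.ζ / (S.ζ + ‖a‖) - S.ζ / (S.ζ + ‖b‖)) • b := by
    simp only [clip]; module
  have h1 : S.ζ / (S.ζ + ‖a‖) ≤ 1 := by
    rw [div_le_one ha]; linarith [norm_nonneg a]
  have h2 : ‖b‖ / (S.ζ + ‖b‖) ≤ 1 := by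
    rw [div_le_one hb]; linarith
  have e2 : S.ζ / (S.ζ + ‖a‖) - S.ζ / (S.ζ + ‖b‖) =
      S.ζ / (S.ζ + ‖a‖) * ((‖b‖ - ‖a‖) / (S.ζ + ‖b‖)) := by
    field_simp; ring
  have h3 : |‖b‖ - ‖a‖| ≤ ‖a - b‖ := by
    rw [abs_sub_comm]; exact abs_norm_sub_norm_le a b
  rw [e]
  refine (norm_add_le _ _).trans ?_
  rw [norm_smul, norm_smul, Real.norm_of_nonneg (by positivity : 0 ≤ S.ζ / (S.ζ + ‖a‖)), e2,
    norm_mul, Real.norm_of_nonneg (by positivity : 0 ≤ S.ζ / (S.ζ + ‖a‖)), norm_div,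
    Real.norm_of_nonneg hb.le, Real.norm_eq_abs]
  have h4 : S.ζ / (S.ζ + ‖a‖) * (|‖b‖ - ‖a‖| / (S.ζ + ‖b‖)) * ‖b‖ =
      S.ζ / (S.ζ + ‖a‖) * (|‖b‖ - ‖a‖| * (‖b‖ / (S.ζ + ‖b‖))) := by ring
  rw [h4]
  have h5 : |‖b‖ - ‖a‖| * (‖b‖ / (S.ζ + ‖b‖)) ≤ ‖a - b‖ * 1 := by gcongr
  have h6 : S.ζ / (S.ζ + ‖a‖) * (|‖b‖ - ‖a‖| * (‖b‖ / (S.ζ + ‖b‖))) ≤ 1 * (‖a - b‖ * 1) := by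
    gcongr
  have h7 : S.ζ / (S.ζ + ‖a‖) * ‖a - b‖ ≤ 1 * ‖a - b‖ := by gcongr
  linarith

/-- Three regimes. If `a` is large and `δ` is at most a quarter of it, then `⟪a, a + δ⟫ ≥ (3/4)‖a‖²`
while the clipping denominator is at most `(9/4)‖a‖`, leaving `ζ‖a‖/3`. If both are large,
boundedness of the clip suffices. If `a` is below the threshold, its own clipping factor is at least
`1/2`, and the 2-Lipschitz bound handles `δ`. -/
theorem inner_clip_self_add (hζ : 0 < S.ζ) (a δ : Vec n) :
    (if S.ζ ≤ ‖a‖ then S.ζ / 4 * ‖a‖ else 1 / 4 * ‖a‖ ^ 2) - 20 * ‖δ‖ ^ 2 ≤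
      inner ℝ a (S.clip (a + δ)) := by
  have hlow : -(S.ζ * ‖a‖) ≤ inner ℝ a (S.clip (a + δ)) := by
    have h1 := abs_le.mp (abs_real_inner_le_norm a (S.clip (a + δ)))
    have h2 := mul_le_mul_of_nonneg_left (S.norm_clip_le hζ (a + δ)) (norm_nonneg a)
    linarith [h1.1]
  split_ifs with h
  · rcases le_or_gt ‖δ‖ (‖a‖ / 4) with hδ | hδ
    · have ha : 0 < ‖a‖ := by linarith
      have hp : 0 < S.ζ + ‖a + δ‖ := by positivity
      have h1 : ‖a + δ‖ ≤ 5 / 4 * ‖a‖ := (norm_add_le _ _).trans (by linarith)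
      have h2 : 3 / 4 * ‖a‖ ^ 2 ≤ inner ℝ a (a + δ) := by
        rw [inner_add_right, real_inner_self_eq_norm_sq]
        have := abs_le.mp (abs_real_inner_le_norm a δ)
        nlinarith [this.1]
      have h3 : S.ζ / 4 * ‖a‖ ≤ inner ℝ a (S.clip (a + δ)) := by
        rw [clip, inner_smul_right, div_mul_eq_mul_div S.ζ (S.ζ + ‖a + δ‖), le_div_iff₀ hp]
        have h4 : S.ζ * (3 / 4 * ‖a‖ ^ 2) ≤ S.ζ * inner ℝ a (a + δ) := by gcongr
        have h5 : S.ζ / 4 * ‖a‖ * (S.ζ + ‖a + δ‖) ≤ S.ζ / 4 * ‖a‖ * (‖a‖ + 5 / 4 * ‖a‖) := by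
          gcongr
        nlinarith [mul_pos hζ (pow_pos ha 2)]
      nlinarith [sq_nonneg ‖δ‖]
    -- Here `(1/4 + 1) ζ‖a‖ ≤ (5/4)‖a‖² ≤ (5/4) · 16 ‖δ‖²`, the source of the constant `20`.
    · nlinarith [norm_nonneg a, norm_nonneg δ]
  · push Not at h
    have hp : 0 < S.ζ + ‖a‖ := by positivity
    have h1 : 1 / 2 * ‖a‖ ^ 2 ≤ inner ℝ a (S.clip a) := by
      rw [clip, inner_smul_right, real_inner_self_eq_norm_sq]
      refine mul_le_mul_of_nonneg_right ?_ (by positivity)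
      rw [le_div_iff₀ hp]; linarith
    have h2 : inner ℝ a (S.clip (a + δ)) =
        inner ℝ a (S.clip a) + inner ℝ a (S.clip (a + δ) - S.clip a) := by
      rw [inner_sub_right]; ring
    have h3 := (abs_le.mp (abs_real_inner_le_norm a (S.clip (a + δ) - S.clip a))).1
    have h4 := S.norm_clip_sub_le hζ (a + δ) a
    rw [add_sub_cancel_left] at h4
    have h5 := mul_le_mul_of_nonneg_left h4 (norm_nonneg a)
    nlinarith [sq_nonneg (‖a‖ / 2 - 2 * ‖δ‖), sq_nonneg ‖δ‖]

/-- One clipped stochastic gradient `g` correlates with the true gradient `∇F(x)`; `h` stands for a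
local gradient close to `∇F(x)`. -/
theorem gap_le_inner_clip {σg : ℝ} (hσ : 0 ≤ σg) (hζ : 0 < S.ζ) (x h g : Vec n) :
    S.gap σg x + 2 * σg * ‖gradient S.F x‖ ≤ inner ℝ (gradient S.F x) (S.clip g) +
      20 * ‖h - gradient S.F x‖ ^ 2 + 2 * (‖gradient S.F x‖ * ‖g - h‖) + 2 * σg * S.ζ := by
  set a := gradient S.F x with ha
  have h1 := S.inner_clip_self_add hζ a (h - a)
  rw [add_sub_cancel] at h1
  have h2 : inner ℝ a (S.clip g) =
      inner ℝ a (S.clip h) + inner ℝ a (S.clip g - S.clip h) := by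
    rw [inner_sub_right]; ring
  have h3 := (abs_le.mp (abs_real_inner_le_norm a (S.clip g - S.clip h))).1
  have h5 := mul_le_mul_of_nonneg_left (S.norm_clip_sub_le hζ g h) (norm_nonneg a)
  rw [gap, ← ha]
  -- Above the threshold the added `2σg‖a‖` completes the gap to `(ζ/4)‖a‖`. Below it, the added
  -- term is at most `2σg ζ`, which is the last summand on the right.
  split_ifs at h1 ⊢ with hc
  · nlinarith [mul_nonneg hσ hζ.le]
  · push Not at hc
    nlinarith [mul_le_mul_of_nonneg_left hc.le hσ]

end

section

/-! ### Dynamics of a single Laplacian mode -/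

section ModeDynamics

variable {E : Type*} [NormedAddCommGroup E]

/-- Lyapunov function of the mode with `s ρ l = a`. -/
def modeEnergy (a : ℝ) (x p : E) : ℝ := 2 * a * (1 - a / 2) * ‖x‖ ^ 2 + ‖p‖ ^ 2

theorem modeEnergy_nonneg {a : ℝ} (h0 : 0 ≤ a) (h2 : a ≤ 2) (x p : E) :
    0 ≤ modeEnergy a x p := by
  have : 0 ≤ 1 - a / 2 := by linarith
  unfold modeEnergy; positivity

theorem norm_sub_sq_le_of_pos (x y : E) {ε : ℝ} (hε : 0 < ε) :
    ‖x - y‖ ^ 2 ≤ (1 + ε) * ‖x‖ ^ 2 + (1 + 1 / ε) * ‖y‖ ^ 2 := by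
  have h1 := norm_sub_le x y
  have h2 : ‖x - y‖ ^ 2 ≤ (‖x‖ + ‖y‖) ^ 2 := pow_le_pow_left₀ (norm_nonneg _) h1 2
  have h3 : (1 + ε) * ‖x‖ ^ 2 + (1 + 1 / ε) * ‖y‖ ^ 2 - (‖x‖ + ‖y‖) ^ 2 =
      (ε * ‖x‖ - ‖y‖) ^ 2 / ε := by
    field_simp; ring
  have h4 : 0 ≤ (ε * ‖x‖ - ‖y‖) ^ 2 / ε := by positivity
  linarith

variable [InnerProductSpace ℝ E]

/-- Without input, a step of the mode dynamics contracts the energy by exactly `1 - a / 2`. -/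
theorem modeEnergy_step (a : ℝ) (x p : E) :
    modeEnergy a ((1 - a / 2) • x - (1 / 2 : ℝ) • p)
        ((a * (1 - a / 2)) • x + (1 - a / 2) • p) = (1 - a / 2) * modeEnergy a x p := by
  simp only [modeEnergy, norm_sub_sq_real, norm_add_sq_real, norm_smul, mul_pow,
    inner_smul_left, inner_smul_right, Real.norm_eq_abs, sq_abs]
  simp only [conj_trivial]
  ring

/-- Young's inequality with `ε = a/4` leaves half of the decay rate, since `(1 + a/4)(1 - a/2) ≤ 1 -
a/4`. The input `(v, a v)` has energy at most of order `a`, which cancels the `4/a` from Young and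
gives a constant free of `a`. -/
theorem modeEnergy_step_le {a : ℝ} (h0 : 0 < a) (h2 : a < 2) (x p v x' : E)
    (hx' : x' = (1 - a / 2) • x - (1 / 2 : ℝ) • p - v) :
    modeEnergy a x' (p + a • x') ≤ (1 - a / 4) * modeEnergy a x p + 12 * ‖v‖ ^ 2 := by
  have e2 : p + a • x' = (a * (1 - a / 2)) • x + (1 - a / 2) • p - a • v := by
    rw [hx']; module
  have hs := modeEnergy_step a x p
  rw [e2, hx']
  set X := (1 - a / 2) • x - (1 / 2 : ℝ) • p
  set Q := (a * (1 - a / 2)) • x + (1 - a / 2) • p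
  have hE := modeEnergy_nonneg h0.le h2.le x p
  have hX := norm_sub_sq_le_of_pos X v (ε := a / 4) (by positivity)
  have hQ := norm_sub_sq_le_of_pos Q (a • v) (ε := a / 4) (by positivity)
  rw [norm_smul, mul_pow, Real.norm_eq_abs, sq_abs] at hQ
  have hθ : 0 ≤ 2 * a * (1 - a / 2) := by
    have : 0 ≤ 1 - a / 2 := by linarith
    positivity
  have h1 := mul_le_mul_of_nonneg_left hX hθ
  have h3 : modeEnergy a (X - v) (Q - a • v) ≤
      (1 + a / 4) * modeEnergy a X Q + (1 + 1 / (a / 4)) * (2 * a) * ‖v‖ ^ 2 := by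
    simp only [modeEnergy]
    linarith
  have h4 : (1 + 1 / (a / 4)) * (2 * a) = 2 * a + 8 := by field_simp; ring
  rw [hs, h4] at h3
  nlinarith [sq_nonneg ‖v‖, mul_nonneg (sq_nonneg a) hE]

theorem sum_modeEnergy_le {a : ℝ} (h0 : 0 < a) (h2 : a < 2) {x p v : ℕ → E}
    (hx : ∀ k, x (k + 1) = (1 - a / 2) • x k - (1 / 2 : ℝ) • p k - v k)
    (hp : ∀ k, p (k + 1) = p k + a • x (k + 1)) (K : ℕ) :
    a / 4 * ∑ k ∈ Finset.range K, modeEnergy a (x k) (p k) ≤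
      modeEnergy a (x 0) (p 0) + 12 * ∑ k ∈ Finset.range K, ‖v k‖ ^ 2 := by
  have key : a / 4 * ∑ k ∈ Finset.range K, modeEnergy a (x k) (p k) + modeEnergy a (x K) (p K) ≤
      modeEnergy a (x 0) (p 0) + 12 * ∑ k ∈ Finset.range K, ‖v k‖ ^ 2 := by
    induction K with
    | zero => simp
    | succ K ih =>
      have := modeEnergy_step_le h0 h2 (x K) (p K) (v K) _ (hx K)
      rw [Finset.sum_range_succ, Finset.sum_range_succ, hp K]
      linarith
  linarith [modeEnergy_nonneg h0.le h2.le (x K) (p K)]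

/-- Constant in the summed consensus bound for the modes with `α ≤ a ≤ A`. -/
def consensusConst (α A : ℝ) : ℝ := (1 + 4 / (2 * α * (1 - A / 2))) * (4 / α) * 74 + 9

theorem consensusConst_pos {α A : ℝ} (hα : 0 < α) (hA : A < 2) : 0 < consensusConst α A := by
  have : 0 < 1 - A / 2 := by linarith
  unfold consensusConst; positivity

theorem sum_mode_le {α A a : ℝ} (hα : 0 < α) (hA : A < 2) (h1 : α ≤ a) (h2 : a ≤ A)
    {x y yt w : ℕ → E}
    (hx : ∀ k, x (k + 1) = x k + y k - w k)
    (hy : ∀ k, y (k + 1) = (1 / 2 : ℝ) • (y k - yt k) - a • x (k + 1))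
    (hyt : ∀ k, yt (k + 1) = (1 / 2 : ℝ) • (yt k - y k)) (K : ℕ) :
    ∑ k ∈ Finset.range K, (‖x k‖ ^ 2 + ‖y k‖ ^ 2) ≤ consensusConst α A *
      (‖x 0‖ ^ 2 + ‖y 0‖ ^ 2 + ‖yt 0‖ ^ 2 + ∑ k ∈ Finset.range K, ‖w k‖ ^ 2) := by
  have ha : 0 < a := by linarith
  have ha2 : a < 2 := by linarith
  have hA' : 0 < 1 - A / 2 := by linarith
  -- `D` is the component along the eigenvalue `0`: it vanishes after one step. With `p = yt - y`
  -- one has `y = D - p/2 - (a/2) x`, so `(x, p)` follows the planar dynamics with input `w - D`.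
  set D : ℕ → E := fun k => (1 / 2 : ℝ) • (y k + yt k + a • x k) with hD
  have hD1 : ∀ k, D (k + 1) = 0 := by
    intro k
    simp only [hD, hy, hyt]; module
  set I := ‖x 0‖ ^ 2 + ‖y 0‖ ^ 2 + ‖yt 0‖ ^ 2 with hI
  set W := ∑ k ∈ Finset.range K, ‖w k‖ ^ 2 with hW
  have hW0 : 0 ≤ W := Finset.sum_nonneg fun _ _ => by positivity
  have hI0 : 0 ≤ I := by positivity
  have hDI : ‖D 0‖ ^ 2 ≤ 3 * I := by
    have := norm_add_three_sq_le (y 0) (yt 0) (a • x 0)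
    rw [norm_smul, mul_pow, Real.norm_eq_abs, sq_abs] at this
    have e : ‖D 0‖ ^ 2 = 1 / 4 * ‖y 0 + yt 0 + a • x 0‖ ^ 2 := by
      simp only [hD, norm_smul, mul_pow]; norm_num
    have : a ^ 2 * ‖x 0‖ ^ 2 ≤ 4 * ‖x 0‖ ^ 2 := by gcongr; nlinarith
    rw [e]
    nlinarith [sq_nonneg ‖y 0‖, sq_nonneg ‖yt 0‖]
  have hsumD : ∑ k ∈ Finset.range K, ‖D k‖ ^ 2 ≤ ‖D 0‖ ^ 2 := by
    cases K with
    | zero => simp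
    | succ K => rw [Finset.sum_range_succ']; simp [hD1]
  have hE := sum_modeEnergy_le ha ha2 (x := x) (p := fun k => yt k - y k) (v := fun k => w k - D k)
    (fun k => by simp only [hx, hD]; module) (fun k => by simp only [hy, hyt]; module) K
  set Φ := ∑ k ∈ Finset.range K, modeEnergy a (x k) (yt k - y k)
  have hΦ : 0 ≤ Φ := Finset.sum_nonneg fun _ _ => modeEnergy_nonneg ha.le ha2.le _ _
  have hv : ∑ k ∈ Finset.range K, ‖w k - D k‖ ^ 2 ≤ 2 * W + 6 * I := by
    calc _ ≤ ∑ k ∈ Finset.range K, (2 * ‖w k‖ ^ 2 + 2 * ‖D k‖ ^ 2) :=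
          Finset.sum_le_sum fun k _ => norm_sub_sq_le _ _
      _ ≤ _ := by
          rw [Finset.sum_add_distrib, ← Finset.mul_sum, ← Finset.mul_sum]; linarith
  have hE0 : modeEnergy a (x 0) (yt 0 - y 0) ≤ 2 * I := by
    have h := norm_sub_sq_le (yt 0) (y 0)
    have : 2 * a * (1 - a / 2) * ‖x 0‖ ^ 2 ≤ 1 * ‖x 0‖ ^ 2 := by
      gcongr; nlinarith [sq_nonneg (a - 1)]
    unfold modeEnergy
    nlinarith [sq_nonneg ‖x 0‖]
  -- `74 = 2 + 12 · 6`: the initial energy is at most `2 I`, and the inputs `w - D` contribute `12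
  -- (2 W + 6 I)`.
  have hΦle : Φ ≤ 4 / α * (74 * (I + W)) := by
    have : α / 4 * Φ ≤ 74 * (I + W) := by
      have : α / 4 * Φ ≤ a / 4 * Φ := by gcongr
      linarith
    rw [div_mul_eq_mul_div, le_div_iff₀ hα]; linarith
  -- A lower bound, uniform over the modes, for the weight of `‖x‖²` in the energy; this is where `A
  -- < 2` enters.
  set μ := 2 * α * (1 - A / 2) with hμ
  have hμ0 : 0 < μ := by positivity
  have hpt : ∀ k, ‖x k‖ ^ 2 + ‖y k‖ ^ 2 ≤
      (1 + 4 / μ) * modeEnergy a (x k) (yt k - y k) + 3 * ‖D k‖ ^ 2 := by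
    intro k
    have e : y k = D k + (-(1 / 2) : ℝ) • (yt k - y k) + (-(a / 2)) • x k := by
      simp only [hD]; module
    have h := norm_add_three_sq_le (D k) ((-(1 / 2) : ℝ) • (yt k - y k)) ((-(a / 2)) • x k)
    have n1 : ‖(-(1 / 2) : ℝ) • (yt k - y k)‖ ^ 2 = 1 / 4 * ‖yt k - y k‖ ^ 2 := by
      rw [norm_smul, mul_pow]; norm_num
    have n2 : ‖(-(a / 2)) • x k‖ ^ 2 = (-(a / 2)) ^ 2 * ‖x k‖ ^ 2 := by
      rw [norm_smul, mul_pow, Real.norm_eq_abs, sq_abs]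
    rw [← e, n1, n2] at h
    have h3 : (-(a / 2)) ^ 2 * ‖x k‖ ^ 2 ≤ 1 * ‖x k‖ ^ 2 := by gcongr; nlinarith
    have h4 : μ * ‖x k‖ ^ 2 ≤ 2 * a * (1 - a / 2) * ‖x k‖ ^ 2 := by
      have : μ ≤ 2 * a * (1 - a / 2) := by rw [hμ]; gcongr
      gcongr
    have h5 : 4 * ‖x k‖ ^ 2 ≤ 4 / μ * modeEnergy a (x k) (yt k - y k) := by
      have : μ * ‖x k‖ ^ 2 ≤ modeEnergy a (x k) (yt k - y k) := by
        unfold modeEnergy; linarith [sq_nonneg ‖yt k - y k‖]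
      rw [div_mul_eq_mul_div, le_div_iff₀ hμ0]; linarith
    have h6 : ‖yt k - y k‖ ^ 2 ≤ modeEnergy a (x k) (yt k - y k) := by
      have : 0 ≤ 2 * a * (1 - a / 2) * ‖x k‖ ^ 2 := (by positivity : 0 ≤ μ * ‖x k‖ ^ 2).trans h4
      unfold modeEnergy; linarith
    linarith [sq_nonneg ‖yt k - y k‖]
  calc _ ≤ ∑ k ∈ Finset.range K,
        ((1 + 4 / μ) * modeEnergy a (x k) (yt k - y k) + 3 * ‖D k‖ ^ 2) :=
        Finset.sum_le_sum fun k _ => hpt k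
    _ ≤ (1 + 4 / μ) * Φ + 3 * ‖D 0‖ ^ 2 := by
        rw [Finset.sum_add_distrib, ← Finset.mul_sum, ← Finset.mul_sum]; linarith
    _ ≤ (1 + 4 / μ) * (4 / α * (74 * (I + W))) + 9 * (I + W) := by
        have : (1 + 4 / μ) * Φ ≤ (1 + 4 / μ) * (4 / α * (74 * (I + W))) := by gcongr
        linarith
    _ = _ := by rw [consensusConst]; ring

end ModeDynamics

end

section

/-! ### Laplacian modes -/

variable {n : ℕ} (S : LTADMMDP n)

/-- Component of a family of vectors along the `j`-th Laplacian eigenvector. -/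
def hat (j : Fin S.N) (v : Fin S.N → Vec n) : Vec n :=
  ∑ i, (S.G.isHermitian_lapMatrix (R := ℝ)).eigenvectorBasis j i • v i

theorem hat_add (j : Fin S.N) (v w : Fin S.N → Vec n) :
    S.hat j (fun i => v i + w i) = S.hat j v + S.hat j w := by
  simp [hat, Finset.sum_add_distrib]

theorem hat_sub (j : Fin S.N) (v w : Fin S.N → Vec n) :
    S.hat j (fun i => v i - w i) = S.hat j v - S.hat j w := by
  simp [hat, smul_sub, Finset.sum_sub_distrib]

theorem hat_smul (j : Fin S.N) (c : ℝ) (v : Fin S.N → Vec n) :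
    S.hat j (fun i => c • v i) = c • S.hat j v := by
  simp [hat, Finset.smul_sum, smul_comm c]

/-- Parseval for the orthonormal eigenbasis, applied in each coordinate of `ℝⁿ`. -/
theorem sum_norm_sq_hat (v : Fin S.N → Vec n) :
    ∑ j, ‖S.hat j v‖ ^ 2 = ∑ i, ‖v i‖ ^ 2 := by
  have h : ∀ l : Fin n, ∑ j, (S.hat j v l) ^ 2 = ∑ i, (v i l) ^ 2 := by
    intro l
    have := (S.G.isHermitian_lapMatrix (R := ℝ)).eigenvectorBasis.sum_sq_norm_inner_right
      (WithLp.toLp 2 fun i => v i l)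
    rw [EuclideanSpace.norm_sq_eq] at this
    simp only [Real.norm_eq_abs, sq_abs, PiLp.inner_apply] at this
    rw [← this]
    refine Finset.sum_congr rfl fun j _ => ?_
    simp [hat, mul_comm]
  simp only [EuclideanSpace.norm_sq_eq, Real.norm_eq_abs, sq_abs]
  rw [Finset.sum_comm, Finset.sum_comm (s := Finset.univ (α := Fin S.N))]
  exact Finset.sum_congr rfl fun l _ => h l

theorem sum_mode_norm_sq_hat_le (v : Fin S.N → Vec n) :
    ∑ j : S.Mode, ‖S.hat j.1 v‖ ^ 2 ≤ ∑ i, ‖v i‖ ^ 2 := by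
  rw [← S.sum_norm_sq_hat v,
    ← Fintype.sum_subtype_add_sum_subtype (fun j => S.lapEig j ≠ 0) fun j => ‖S.hat j v‖ ^ 2]
  exact le_add_of_nonneg_right (Finset.sum_nonneg fun _ _ => by positivity)

theorem hat_lap (j : Fin S.N) (v : Fin S.N → Vec n) :
    S.hat j (fun i => (S.G.degree i : ℝ) • v i - ∑ k ∈ S.G.neighborFinset i, v k) =
      S.lapEig j • S.hat j v := by
  have h1 : ∀ i, (S.G.degree i : ℝ) • v i - ∑ k ∈ S.G.neighborFinset i, v k =
      ∑ k, S.G.lapMatrix ℝ i k • v k := by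
    intro i
    ext l
    have := S.G.lapMatrix_mulVec_apply (R := ℝ) i (fun k => v k l)
    simp only [Matrix.mulVec, dotProduct] at this
    simp [this]
  have h2 : ∀ k, ∑ i, (S.G.isHermitian_lapMatrix (R := ℝ)).eigenvectorBasis j i *
      S.G.lapMatrix ℝ i k = S.lapEig j *
        (S.G.isHermitian_lapMatrix (R := ℝ)).eigenvectorBasis j k := by
    intro k
    have := congrFun ((S.G.isHermitian_lapMatrix (R := ℝ)).mulVec_eigenvectorBasis j) k
    simp only [Matrix.mulVec, dotProduct, Pi.smul_apply, smul_eq_mul] at this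
    rw [lapEig, ← this]
    refine Finset.sum_congr rfl fun i _ => ?_
    rw [mul_comm, (S.G.isSymm_lapMatrix (R := ℝ)).apply]
  simp only [hat, h1, Finset.smul_sum, smul_smul]
  rw [Finset.sum_comm]
  refine Finset.sum_congr rfl fun k _ => ?_
  rw [← Finset.sum_smul, h2]

theorem hasEigenvalue_lapEig (j : Fin S.N) :
    Module.End.HasEigenvalue (Matrix.toLin' (S.G.lapMatrix ℝ)) (S.lapEig j) := by
  refine Module.End.hasEigenvalue_of_hasEigenvector
    (x := ((S.G.isHermitian_lapMatrix (R := ℝ)).eigenvectorBasis j).ofLp) ⟨?_, ?_⟩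
  · rw [Module.End.mem_eigenspace_iff, Matrix.toLin'_apply]
    exact (S.G.isHermitian_lapMatrix (R := ℝ)).mulVec_eigenvectorBasis j
  · intro h
    have := (S.G.isHermitian_lapMatrix (R := ℝ)).eigenvectorBasis.orthonormal.ne_zero j
    exact this (by ext i; exact congrFun h i)

theorem hat_const_of_lapEig_ne_zero {j : Fin S.N} (hj : S.lapEig j ≠ 0) (c : Vec n) :
    S.hat j (fun _ => c) = 0 := by
  have := S.hat_lap j (fun _ => c)
  have h0 : (fun i => (S.G.degree i : ℝ) • c - ∑ k ∈ S.G.neighborFinset i, c) =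
      fun _ => (0 : Vec n) := by
    funext i
    simp [Nat.cast_smul_eq_nsmul]
  rw [h0] at this
  have h1 : S.hat j (fun _ => (0 : Vec n)) = 0 := by simp [hat]
  rw [h1] at this
  exact (smul_eq_zero.mp this.symm).resolve_left hj

/-- On a connected graph a null vector of the Laplacian is constant, so its component of `v` is a
multiple of `∑ i, v i`. -/
theorem hat_eq_zero_of_sum_eq_zero (hG : S.G.Connected) {j : Fin S.N} (hj : S.lapEig j = 0)
    {v : Fin S.N → Vec n} (hv : ∑ i, v i = 0) : S.hat j v = 0 := by
  have h := (S.G.isHermitian_lapMatrix (R := ℝ)).mulVec_eigenvectorBasis j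
  have hj' : (S.G.isHermitian_lapMatrix (R := ℝ)).eigenvalues j = 0 := hj
  rw [hj', zero_smul, S.G.lapMatrix_mulVec_eq_zero_iff_forall_reachable] at h
  obtain ⟨i₀⟩ := hG.nonempty
  have : S.hat j v = (S.G.isHermitian_lapMatrix (R := ℝ)).eigenvectorBasis j i₀ • ∑ i, v i := by
    rw [hat, Finset.smul_sum]
    refine Finset.sum_congr rfl fun i _ => ?_
    rw [h i i₀ (hG.preconnected i i₀)]
  rw [this, hv, smul_zero]

theorem sum_mode_norm_sq_hat (hG : S.G.Connected) {v : Fin S.N → Vec n} (hv : ∑ i, v i = 0) :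
    ∑ j : S.Mode, ‖S.hat j.1 v‖ ^ 2 = ∑ i, ‖v i‖ ^ 2 := by
  rw [← S.sum_norm_sq_hat v,
    ← Fintype.sum_subtype_add_sum_subtype (fun j => S.lapEig j ≠ 0) fun j => ‖S.hat j v‖ ^ 2,
    left_eq_add]
  refine Finset.sum_eq_zero fun j _ => ?_
  rw [S.hat_eq_zero_of_sum_eq_zero hG (not_not.mp j.2) hv]
  simp

theorem sum_sub_mean (hG : S.G.Connected) (v : Fin S.N → Vec n) : ∑ i, (v i - S.mean v) = 0 := by
  obtain ⟨i₀⟩ := hG.nonempty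
  have hN : (S.N : ℝ) ≠ 0 := by
    have := i₀.pos
    positivity
  simp only [mean, Finset.sum_sub_distrib, Finset.sum_const, Finset.card_univ, Fintype.card_fin]
  rw [← Nat.cast_smul_eq_nsmul ℝ, smul_smul, mul_inv_cancel₀ hN, one_smul, sub_self]

/-- Subtracting the mean removes the null modes and leaves the others unchanged, so the nonzero
modes carry the whole consensus error. -/
theorem sum_norm_sq_sub_mean (hG : S.G.Connected) (v : Fin S.N → Vec n) :
    ∑ i, ‖v i - S.mean v‖ ^ 2 = ∑ j : S.Mode, ‖S.hat j.1 v‖ ^ 2 := by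
  rw [← S.sum_mode_norm_sq_hat hG (S.sum_sub_mean hG v)]
  refine Finset.sum_congr rfl fun j _ => ?_
  rw [hat_sub, S.hat_const_of_lapEig_ne_zero j.2, sub_zero]

end

section

/-! ### The constant `‖d̂₀‖²` -/

theorem normSq_modeEig_sub_one {s ρ l : ℝ} (h0 : 0 < s * ρ * l) (h2 : s * ρ * l < 2) :
    Complex.normSq (modeEig s ρ l - 1) = s * ρ * l / 2 := by
  have h := Real.sq_sqrt (mul_nonneg h0.le (by linarith : 0 ≤ 2 - s * ρ * l))
  rw [Complex.normSq_apply]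
  simp only [modeEig, Complex.sub_re, Complex.sub_im, Complex.one_re, Complex.one_im, sub_zero]
  linear_combination h / 4

theorem normSq_one_sub_two_mul_modeEig {s ρ l : ℝ} (h0 : 0 < s * ρ * l) (h2 : s * ρ * l < 2) :
    Complex.normSq (1 - 2 * modeEig s ρ l) = 1 := by
  have h := Real.sq_sqrt (mul_nonneg h0.le (by linarith : 0 ≤ 2 - s * ρ * l))
  rw [Complex.normSq_apply]
  simp only [modeEig, Complex.sub_re, Complex.sub_im, Complex.one_re, Complex.one_im,
    Complex.mul_re, Complex.mul_im, Complex.re_ofNat, Complex.im_ofNat]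
  linear_combination h

theorem norm_sq_modeV_le {s ρ l : ℝ} (h0 : 0 < s * ρ * l) (h2 : s * ρ * l < 2) (p q : Fin 3) :
    ‖modeV s ρ l p q‖ ^ 2 ≤ ![s ^ 2 * (1 + 2 / (s * ρ * l)), 1, 1] p := by
  have hw : (√(2 / (s * ρ * l))) * (√(2 / (s * ρ * l))) = 2 / (s * ρ * l) :=
    Real.mul_self_sqrt (by positivity)
  have e1 := normSq_modeEig_sub_one h0 h2
  have e2 := normSq_one_sub_two_mul_modeEig h0 h2
  have e3 : Complex.normSq ((starRingEnd ℂ) (modeEig s ρ l) - 1) = s * ρ * l / 2 := by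
    rw [← e1, ← Complex.normSq_conj]; simp
  have e4 : Complex.normSq (1 - 2 * (starRingEnd ℂ) (modeEig s ρ l)) = 1 := by
    rw [← e2, ← Complex.normSq_conj, map_sub, map_mul, Complex.conj_conj, map_one, map_ofNat]
  have hd : 2 / (s * ρ * l) * (s * ρ * l / 2) = 1 := by
    rw [div_mul_div_comm, mul_comm, div_self (by positivity)]
  have hp : 0 < 2 / (s * ρ * l) := by positivity
  rw [Complex.sq_norm, modeV]
  generalize √(2 / (s * ρ * l)) = w at hw
  fin_cases p <;> fin_cases q <;>
    simp [Complex.normSq_mul, Complex.normSq_ofReal, hw, e1, e2, e3, e4, hd,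
      -map_sub] <;> nlinarith [sq_nonneg s, mul_nonneg (sq_nonneg s) hp.le]

variable {n : ℕ} (S : LTADMMDP n)

theorem V_mul_d0 (h : ∀ j : S.Mode, 0 < S.β * S.τ * S.ρ * S.lapEig j.1 ∧
      S.β * S.τ * S.ρ * S.lapEig j.1 < 2) :
    S.V * S.d0 = Matrix.of fun (p : Fin 3 × S.Mode) l =>
      ((S.hat p.2.1 (![S.x0, S.Y0, S.Yt0] p.1) l : ℝ) : ℂ) := by
  have hdet : IsUnit S.V.det := by
    rw [V, Matrix.det_blockDiagonal, isUnit_iff_ne_zero, Finset.prod_ne_zero_iff]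
    exact fun j _ => det_modeV_ne_zero (h j).1 (h j).2
  have e : S.d0 = (S.V⁻¹ : Matrix _ _ ℂ) * (Matrix.of fun (p : Fin 3 × S.Mode) l =>
    ((∑ i, S.Q i p.2 * (![S.x0 i, S.Y0 i, S.Yt0 i] p.1) l : ℝ) : ℂ) :
      Matrix (Fin 3 × S.Mode) (Fin n) ℂ) := rfl
  rw [e, ← Matrix.mul_assoc, Matrix.mul_nonsing_inv _ hdet, Matrix.one_mul]
  ext ⟨p, j⟩ l
  simp only [Matrix.of_apply, hat, Q]
  norm_cast
  fin_cases p <;> simp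

/-- The initial modes are `V̂ d̂₀`, so only the sizes of the entries of `V̂` are needed. In the
scaling by `βτ` all three rows carry the common factor `(βτ)²`, which later becomes the `1/ρ²` of
the estimate. The `9` is three terms per row from Cauchy-Schwarz, times three rows. -/
theorem sum_norm_sq_hat_init_le {α : ℝ} (hα : 0 < α)
    (h : ∀ j : S.Mode, α ≤ S.β * S.τ * S.ρ * S.lapEig j.1 ∧
      S.β * S.τ * S.ρ * S.lapEig j.1 < 2) :
    ∑ j : S.Mode, (‖S.hat j.1 S.x0‖ ^ 2 + (S.β * S.τ) ^ 2 * ‖S.hat j.1 S.Y0‖ ^ 2 +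
      (S.β * S.τ) ^ 2 * ‖S.hat j.1 S.Yt0‖ ^ 2) ≤
      9 * (1 + 2 / α) * (S.β * S.τ) ^ 2 * S.d0NormSq := by
  have hV := S.V_mul_d0 fun j => ⟨hα.trans_le (h j).1, (h j).2⟩
  set s := S.β * S.τ
  have hent : ∀ (p : Fin 3) (j : S.Mode),
      ![1, s ^ 2, s ^ 2] p * ‖S.hat j.1 (![S.x0, S.Y0, S.Yt0] p)‖ ^ 2 ≤
        3 * (1 + 2 / α) * s ^ 2 * ∑ q, ∑ l, ‖S.d0 (q, j) l‖ ^ 2 := by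
    intro p j
    have hj0 : 0 < s * S.ρ * S.lapEig j.1 := hα.trans_le (h j).1
    have hc : ∀ l, ![1, s ^ 2, s ^ 2] p * (S.hat j.1 (![S.x0, S.Y0, S.Yt0] p) l) ^ 2 ≤
        3 * (1 + 2 / α) * s ^ 2 * ∑ q, ‖S.d0 (q, j) l‖ ^ 2 := by
      intro l
      have e : ((S.hat j.1 (![S.x0, S.Y0, S.Yt0] p) l : ℝ) : ℂ) =
          ∑ q, modeV s S.ρ (S.lapEig j.1) p q * S.d0 (q, j) l := by
        have := congrFun (congrFun hV (p, j)) l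
        rw [Matrix.of_apply] at this
        rw [← this, Matrix.mul_apply, Fintype.sum_prod_type]
        refine Finset.sum_congr rfl fun q _ => ?_
        rw [Finset.sum_eq_single j]
        · simp [V, s]
        · intro b _ hb
          simp [V, Matrix.blockDiagonal_apply, hb.symm]
        · simp
      have e1 : (S.hat j.1 (![S.x0, S.Y0, S.Yt0] p) l) ^ 2 =
          ‖∑ q, modeV s S.ρ (S.lapEig j.1) p q * S.d0 (q, j) l‖ ^ 2 := by
        rw [← e, Complex.norm_real, Real.norm_eq_abs, sq_abs]
      have e2 := norm_sum_sq_le Finset.univ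
        fun q => modeV s S.ρ (S.lapEig j.1) p q * S.d0 (q, j) l
      simp only [Finset.card_univ, Fintype.card_fin, norm_mul, mul_pow] at e2
      have h0 : (0 : ℝ) ≤ ![1, s ^ 2, s ^ 2] p := by fin_cases p <;> simp [sq_nonneg]
      have e3 : ∀ q, ![1, s ^ 2, s ^ 2] p * ‖modeV s S.ρ (S.lapEig j.1) p q‖ ^ 2 ≤
          (1 + 2 / α) * s ^ 2 := by
        intro q
        have h1 := mul_le_mul_of_nonneg_left (norm_sq_modeV_le hj0 (h j).2 p q) h0
        refine h1.trans ?_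
        have h3 : 2 / (s * S.ρ * S.lapEig j.1) ≤ 2 / α := by gcongr; exact (h j).1
        have h4 : 0 < 2 / α := by positivity
        fin_cases p <;> simp <;> nlinarith [sq_nonneg s]
      rw [e1]
      refine (mul_le_mul_of_nonneg_left e2 h0).trans ?_
      rw [mul_left_comm, Finset.mul_sum, Finset.mul_sum, Finset.mul_sum]
      refine Finset.sum_le_sum fun q _ => ?_
      nlinarith [mul_le_mul_of_nonneg_right (e3 q) (sq_nonneg ‖S.d0 (q, j) l‖)]
    rw [EuclideanSpace.norm_sq_eq, Finset.mul_sum, Finset.sum_comm, Finset.mul_sum]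
    exact Finset.sum_le_sum fun l _ => by
      simpa only [Real.norm_eq_abs, sq_abs] using hc l
  have e : S.d0NormSq = ∑ j : S.Mode, ∑ q, ∑ l, ‖S.d0 (q, j) l‖ ^ 2 := by
    rw [d0NormSq, Fintype.sum_prod_type, Finset.sum_comm]
  rw [e, Finset.mul_sum]
  refine Finset.sum_le_sum fun j _ => ?_
  have h0 := hent 0 j
  have h1 := hent 1 j
  have h2 := hent 2 j
  simp only [Matrix.cons_val_zero, Matrix.cons_val_one, Matrix.cons_val, one_mul] at h0 h1 h2
  linarith

end

section

/-! ### Consequences of the standing assumptions -/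

variable {n : ℕ} (S : LTADMMDP n)

namespace Assumptions

variable {S} {L σf σg ll lu : ℝ} {xstar : Vec n}

theorem N_pos (hA : S.Assumptions L σf σg ll lu xstar) : 0 < (S.N : ℝ) := by
  obtain ⟨i₀⟩ := hA.connected.nonempty
  exact_mod_cast i₀.pos

theorem ζ_pos (hA : S.Assumptions L σf σg ll lu xstar) : 0 < S.ζ := by
  linarith [hA.ζ_large, hA.σg_pos]

theorem τ_pos' (hA : S.Assumptions L σf σg ll lu xstar) : 0 < (S.τ : ℝ) := by
  exact_mod_cast hA.τ_pos

theorem ll_pos (hA : S.Assumptions L σf σg ll lu xstar) : 0 < ll := by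
  obtain ⟨hne, hev⟩ := hA.ll_least.1
  refine lt_of_le_of_ne ?_ hne.symm
  obtain ⟨v, hv⟩ := hev.exists_hasEigenvector
  have h1 : (S.G.lapMatrix ℝ).mulVec v = ll • v := by
    rw [← Matrix.toLin'_apply]; exact hv.apply_eq_smul
  have h2 := (S.G.posSemidef_lapMatrix ℝ).dotProduct_mulVec_nonneg v
  rw [h1, dotProduct_smul, smul_eq_mul, star_trivial] at h2
  have h3 : 0 < dotProduct v v :=
    lt_of_le_of_ne (by simpa using dotProduct_star_self_nonneg v)
      (Ne.symm (by simpa [dotProduct_self_eq_zero] using hv.2))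
  by_contra h
  push Not at h
  nlinarith

theorem lapEig_mem (hA : S.Assumptions L σf σg ll lu xstar)
    (j : S.Mode) : ll ≤ S.lapEig j.1 ∧ S.lapEig j.1 ≤ lu :=
  ⟨hA.ll_least.2 ⟨j.2, S.hasEigenvalue_lapEig j.1⟩, hA.lu_greatest.2 (S.hasEigenvalue_lapEig j.1)⟩

theorem lu_pos (hA : S.Assumptions L σf σg ll lu xstar) : 0 < lu :=
  hA.ll_pos.trans_le (hA.lu_greatest.2 hA.ll_least.1.2)

theorem mul_lu_lt_two (hA : S.Assumptions L σf σg ll lu xstar) : S.β * S.τ * S.ρ * lu < 2 := by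
  have h := hA.β_small
  have h1 := hA.τ_pos'
  have h2 := hA.lu_pos
  have h3 := hA.ρ_pos
  rw [lt_div_iff₀ (by positivity)] at h
  linarith

theorem mode_mem (hA : S.Assumptions L σf σg ll lu xstar)
    (j : S.Mode) :
    S.β * S.τ * S.ρ * ll ≤ S.β * S.τ * S.ρ * S.lapEig j.1 ∧
      S.β * S.τ * S.ρ * S.lapEig j.1 ≤ S.β * S.τ * S.ρ * lu := by
  have h1 := hA.τ_pos'
  have h2 := hA.ρ_pos
  have h3 := hA.β_pos
  obtain ⟨h4, h5⟩ := hA.lapEig_mem j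
  constructor <;> gcongr

theorem differentiable_f (hA : S.Assumptions L σf σg ll lu xstar)
    (i : Fin S.N) : Differentiable ℝ (S.f i) := fun x =>
  (hasGradientAt_const_mul_sum Finset.univ _
    fun h _ => (hA.differentiable i h x).hasGradientAt).differentiableAt

theorem hasGradientAt_F (hA : S.Assumptions L σf σg ll lu xstar)
    (x : Vec n) :
    HasGradientAt S.F (S.mean fun i => gradient (S.f i) x) x :=
  hasGradientAt_const_mul_sum Finset.univ _ fun i _ => (hA.differentiable_f i x).hasGradientAt

theorem gradient_F (hA : S.Assumptions L σf σg ll lu xstar)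
    (x : Vec n) : gradient S.F x = S.mean fun i => gradient (S.f i) x :=
  (hA.hasGradientAt_F x).gradient

theorem differentiable_F (hA : S.Assumptions L σf σg ll lu xstar) : Differentiable ℝ S.F := fun x =>
  (hA.hasGradientAt_F x).differentiableAt

theorem smooth_F (hA : S.Assumptions L σf σg ll lu xstar)
    (x y : Vec n) : ‖gradient S.F x - gradient S.F y‖ ≤ L * ‖x - y‖ := by
  have hN := hA.N_pos
  rw [hA.gradient_F, hA.gradient_F, mean, mean, ← smul_sub, ← Finset.sum_sub_distrib, norm_smul,
    Real.norm_of_nonneg (by positivity), inv_mul_le_iff₀ hN]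
  refine (norm_sum_le _ _).trans ((Finset.sum_le_sum fun i _ => hA.smooth i x y).trans ?_)
  simp

theorem sum_mode_norm_sq_hat_gradient_le (hA : S.Assumptions L σf σg ll lu xstar)
    (x : Vec n) :
    ∑ j : S.Mode, ‖S.hat j.1 fun i => gradient (S.f i) x‖ ^ 2 ≤ S.N * σf ^ 2 := by
  rw [← S.sum_norm_sq_sub_mean hA.connected, ← hA.gradient_F]
  calc _ ≤ ∑ i : Fin S.N, σf ^ 2 := by
        refine Finset.sum_le_sum fun i _ => ?_
        rw [norm_sub_rev]
        exact pow_le_pow_left₀ (norm_nonneg _) (hA.variation i x) 2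
    _ = _ := by simp

end Assumptions

/-! ### Trajectories -/

theorem sum_neighbors_comm (w : Fin S.N → Fin S.N → Vec n) :
    ∑ i, ∑ j ∈ S.G.neighborFinset i, w i j = ∑ i, ∑ j ∈ S.G.neighborFinset i, w j i :=
  Finset.sum_comm' (by simp [SimpleGraph.adj_comm])

variable (B : ℕ → ℕ → (i : Fin S.N) → Finset (Fin (S.m i))) (e : ℕ → ℕ → Fin S.N → Vec n)

/-- Model of agent `i` after `t` local steps of round `k`. -/
def phi (k t : ℕ) : Fin S.N → Vec n :=
  S.localTrain (S.state B e k).1 (S.state B e k).2 (B k) (e k) t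

/-- Stochastic gradient of agent `i` at local step `t` of round `k`. -/
def grad (k t : ℕ) (i : Fin S.N) : Vec n := S.batchGrad i (B k t i) (S.phi B e k t i)

/-- Sum of the first `t` noisy clipped gradients of round `k`. -/
def drift (k t : ℕ) (i : Fin S.N) : Vec n :=
  ∑ r ∈ Finset.range t, (S.clip (S.grad B e k r i) + e k r i)

/-- `Aᵀ Z - ρ D X` after `k` rounds. -/
def outY (k : ℕ) (i : Fin S.N) : Vec n :=
  ∑ j ∈ S.G.neighborFinset i, (S.state B e k).2 i j -
    (S.ρ * (S.G.degree i : ℝ)) • (S.state B e k).1 i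

/-- `Aᵀ P Z - ρ D X` after `k` rounds. -/
def inY (k : ℕ) (i : Fin S.N) : Vec n :=
  ∑ j ∈ S.G.neighborFinset i, (S.state B e k).2 j i -
    (S.ρ * (S.G.degree i : ℝ)) • (S.state B e k).1 i

/-- The consensus correction is frozen during a round, so it accumulates linearly in `t`. -/
theorem phi_eq (k t : ℕ) (i : Fin S.N) :
    S.phi B e k t i = (S.state B e k).1 i + (t * S.β) • S.outY B e k i -
      S.γ • S.drift B e k t i := by
  induction t with
  | zero => simp [phi, localTrain, drift]
  | succ t ih =>
    have h : S.phi B e k (t + 1) i = S.phi B e k t i -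
        (S.γ • (S.clip (S.grad B e k t i) + e k t i) - S.β • S.outY B e k i) := by
      simp only [phi, localTrain, grad, outY]; module
    rw [h, ih, drift, drift, Finset.sum_range_succ]
    push_cast
    module

theorem state_succ_fst (k : ℕ) (i : Fin S.N) :
    (S.state B e (k + 1)).1 i = (S.state B e k).1 i + (S.β * S.τ) • S.outY B e k i -
      S.γ • S.drift B e k S.τ i := by
  rw [mul_comm S.β, ← S.phi_eq]; rfl

theorem inY_succ (k : ℕ) (i : Fin S.N) :
    S.inY B e (k + 1) i = (1 / 2 : ℝ) • (S.inY B e k i - S.outY B e k i) := by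
  have h : ∀ j, (S.state B e (k + 1)).2 j i = (1 / 2 : ℝ) • (S.state B e k).2 j i -
      (1 / 2 : ℝ) • ((S.state B e k).2 i j - (2 * S.ρ) • (S.state B e (k + 1)).1 i) :=
    fun j => rfl
  simp only [inY, outY, h, Finset.sum_sub_distrib, ← Finset.smul_sum, Finset.sum_const,
    SimpleGraph.card_neighborFinset_eq_degree, ← Nat.cast_smul_eq_nsmul ℝ]
  module

theorem outY_succ (k : ℕ) (i : Fin S.N) :
    S.outY B e (k + 1) i = (1 / 2 : ℝ) • (S.outY B e k i - S.inY B e k i) -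
      S.ρ • ((S.G.degree i : ℝ) • (S.state B e (k + 1)).1 i -
        ∑ j ∈ S.G.neighborFinset i, (S.state B e (k + 1)).1 j) := by
  have h : ∀ j, (S.state B e (k + 1)).2 i j = (1 / 2 : ℝ) • (S.state B e k).2 i j -
      (1 / 2 : ℝ) • ((S.state B e k).2 j i - (2 * S.ρ) • (S.state B e (k + 1)).1 j) :=
    fun j => rfl
  simp only [inY, outY, h, Finset.sum_sub_distrib, ← Finset.smul_sum]
  module

/-- Initially this is the balance condition. Afterwards, reversing all edges shows that `outY` and
`inY` have the same sum, and a Laplacian image sums to zero. -/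
theorem sum_outY {L σf σg ll lu : ℝ} {xstar : Vec n} (hA : S.Assumptions L σf σg ll lu xstar)
    (k : ℕ) : ∑ i, S.outY B e k i = 0 := by
  cases k with
  | zero =>
    simp only [outY, state, Finset.sum_sub_distrib, hA.init, Finset.smul_sum, smul_smul, sub_self]
  | succ k =>
    have h1 : ∑ i, S.outY B e k i = ∑ i, S.inY B e k i := by
      simp only [outY, inY, Finset.sum_sub_distrib]
      rw [S.sum_neighbors_comm]
    have h2 := S.sum_neighbors_comm fun i j => (S.state B e (k + 1)).1 j
    simp only [Finset.sum_const, SimpleGraph.card_neighborFinset_eq_degree,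
      ← Nat.cast_smul_eq_nsmul ℝ] at h2
    simp only [outY_succ, Finset.sum_sub_distrib, ← Finset.smul_sum, h1, h2, sub_self, smul_zero]

theorem xbar_succ {L σf σg ll lu : ℝ} {xstar : Vec n} (hA : S.Assumptions L σf σg ll lu xstar)
    (k : ℕ) : S.xbar B e (k + 1) = S.xbar B e k - S.γ • S.mean (S.drift B e k S.τ) := by
  simp only [xbar, mean, state_succ_fst, Finset.sum_sub_distrib, Finset.sum_add_distrib,
    ← Finset.smul_sum, S.sum_outY B e hA]
  module

/-! ### Consensus error -/

/-- Deviation of the models from consensus after `k` rounds. -/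
def consensusErr (k : ℕ) : ℝ :=
  ∑ i, (‖(S.state B e k).1 i - S.xbar B e k‖ ^ 2 + ‖(S.β * S.τ) • S.outY B e k i‖ ^ 2)

/-- The whole drift is treated as an external input of each mode. No gradient is subtracted from
`outY` and `inY`; the shift by `(γ/β)∇f_i` in `Y₀` and `Ỹ₀` is undone only at round `0`, at a price
controlled by `σf`. -/
theorem sum_consensusErr_le {L σf σg ll lu : ℝ} {xstar : Vec n}
    (hA : S.Assumptions L σf σg ll lu xstar) (K : ℕ) :
    ∑ k ∈ Finset.range K, S.consensusErr B e k ≤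
      consensusConst (S.β * S.τ * S.ρ * ll) (S.β * S.τ * S.ρ * lu) *
        (18 * (1 + 2 / (S.β * S.τ * S.ρ * ll)) * (S.β * S.τ) ^ 2 * S.d0NormSq +
          4 * (S.γ * S.τ) ^ 2 * S.N * σf ^ 2 +
          S.γ ^ 2 * ∑ k ∈ Finset.range K, ∑ i, ‖S.drift B e k S.τ i‖ ^ 2) := by
  have hα : 0 < S.β * S.τ * S.ρ * ll := by
    have := hA.β_pos
    have := hA.τ_pos'
    have := hA.ρ_pos
    have := hA.ll_pos
    positivity
  have hA2 := hA.mul_lu_lt_two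
  have hC := consensusConst_pos hα hA2
  have hmode : ∀ j : S.Mode, ∑ k ∈ Finset.range K, (‖S.hat j.1 (S.state B e k).1‖ ^ 2 +
      ‖(S.β * S.τ) • S.hat j.1 (S.outY B e k)‖ ^ 2) ≤
      consensusConst (S.β * S.τ * S.ρ * ll) (S.β * S.τ * S.ρ * lu) *
      (‖S.hat j.1 (S.state B e 0).1‖ ^ 2 + ‖(S.β * S.τ) • S.hat j.1 (S.outY B e 0)‖ ^ 2 +
        ‖(S.β * S.τ) • S.hat j.1 (S.inY B e 0)‖ ^ 2 +
        ∑ k ∈ Finset.range K, ‖S.γ • S.hat j.1 (S.drift B e k S.τ)‖ ^ 2) := by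
    intro j
    -- Scaling `outY` and `inY` by `βτ` brings the mode to normal form with `a = βτρλ_j` and input
    -- `γ` times the drift.
    refine sum_mode_le hα hA2 (hA.mode_mem j).1 (hA.mode_mem j).2
      (x := fun k => S.hat j.1 (S.state B e k).1)
      (y := fun k => (S.β * S.τ) • S.hat j.1 (S.outY B e k))
      (yt := fun k => (S.β * S.τ) • S.hat j.1 (S.inY B e k)) ?_ ?_ ?_ K
    · intro k
      have : (S.state B e (k + 1)).1 = fun i => (S.state B e k).1 i +
          (S.β * S.τ) • S.outY B e k i - S.γ • S.drift B e k S.τ i :=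
        funext (S.state_succ_fst B e k)
      rw [this, hat_sub, hat_add, hat_smul, hat_smul]
    · intro k
      have : S.outY B e (k + 1) = fun i => (1 / 2 : ℝ) • (S.outY B e k i - S.inY B e k i) -
          S.ρ • ((S.G.degree i : ℝ) • (S.state B e (k + 1)).1 i -
            ∑ j ∈ S.G.neighborFinset i, (S.state B e (k + 1)).1 j) :=
        funext (S.outY_succ B e k)
      rw [this, hat_sub, hat_smul, hat_sub, hat_smul, hat_lap]
      module
    · intro k
      have : S.inY B e (k + 1) = fun i => (1 / 2 : ℝ) • (S.inY B e k i - S.outY B e k i) :=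
        funext (S.inY_succ B e k)
      rw [this, hat_smul, hat_sub]
      module
  have hlhs : ∑ k ∈ Finset.range K, S.consensusErr B e k =
      ∑ j : S.Mode, ∑ k ∈ Finset.range K, (‖S.hat j.1 (S.state B e k).1‖ ^ 2 +
        ‖(S.β * S.τ) • S.hat j.1 (S.outY B e k)‖ ^ 2) := by
    rw [Finset.sum_comm]
    refine Finset.sum_congr rfl fun k _ => ?_
    rw [consensusErr, Finset.sum_add_distrib, Finset.sum_add_distrib, xbar,
      S.sum_norm_sq_sub_mean hA.connected]
    simp only [norm_smul, mul_pow]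
    rw [← Finset.mul_sum, ← Finset.mul_sum,
      S.sum_mode_norm_sq_hat hA.connected (S.sum_outY B e hA k)]
  have hdrift : ∑ j : S.Mode, ∑ k ∈ Finset.range K, ‖S.γ • S.hat j.1 (S.drift B e k S.τ)‖ ^ 2 ≤
      S.γ ^ 2 * ∑ k ∈ Finset.range K, ∑ i, ‖S.drift B e k S.τ i‖ ^ 2 := by
    rw [Finset.sum_comm, Finset.mul_sum]
    refine Finset.sum_le_sum fun k _ => ?_
    simp only [norm_smul, mul_pow, Real.norm_eq_abs, sq_abs]
    rw [← Finset.mul_sum]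
    exact mul_le_mul_of_nonneg_left (S.sum_mode_norm_sq_hat_le _) (sq_nonneg _)
  have hβ := hA.β_pos.ne'
  set g : Fin S.N → Vec n := fun i => gradient (S.f i) (S.mean S.x0) with hg
  have hout : ∀ j, (S.β * S.τ) • S.hat j (S.outY B e 0) =
      (S.β * S.τ) • S.hat j S.Y0 + (S.γ * S.τ) • S.hat j g := by
    intro j
    have : S.outY B e 0 = fun i => S.Y0 i + (S.γ / S.β) • g i := by
      funext i
      simp only [outY, state, Y0, hg]
      module
    rw [this, hat_add, hat_smul, smul_add, smul_smul]
    congr 2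
    field_simp
  have hin : ∀ j, (S.β * S.τ) • S.hat j (S.inY B e 0) =
      (S.β * S.τ) • S.hat j S.Yt0 - (S.γ * S.τ) • S.hat j g := by
    intro j
    have : S.inY B e 0 = fun i => S.Yt0 i - (S.γ / S.β) • g i := by
      funext i
      simp only [inY, state, Yt0, hg]
      module
    rw [this, hat_sub, hat_smul, smul_sub, smul_smul]
    congr 2
    field_simp
  have hinit : ∑ j : S.Mode, (‖S.hat j.1 (S.state B e 0).1‖ ^ 2 +
      ‖(S.β * S.τ) • S.hat j.1 (S.outY B e 0)‖ ^ 2 +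
        ‖(S.β * S.τ) • S.hat j.1 (S.inY B e 0)‖ ^ 2) ≤
      18 * (1 + 2 / (S.β * S.τ * S.ρ * ll)) * (S.β * S.τ) ^ 2 * S.d0NormSq +
          4 * (S.γ * S.τ) ^ 2 * S.N * σf ^ 2 := by
    have h1 := S.sum_norm_sq_hat_init_le hα
      fun j => ⟨(hA.mode_mem j).1, (hA.mode_mem j).2.trans_lt hA2⟩
    -- Only the nonconstant modes of the local gradients at `x̄₀` occur, that is, their deviations
    -- from `∇F`, at most `σf` each.
    have h2 := mul_le_mul_of_nonneg_left (hA.sum_mode_norm_sq_hat_gradient_le (S.mean S.x0))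
      (sq_nonneg (S.γ * S.τ))
    have h3 : ∀ j : S.Mode, ‖S.hat j.1 (S.state B e 0).1‖ ^ 2 +
        ‖(S.β * S.τ) • S.hat j.1 (S.outY B e 0)‖ ^ 2 +
        ‖(S.β * S.τ) • S.hat j.1 (S.inY B e 0)‖ ^ 2 ≤
        2 * (‖S.hat j.1 S.x0‖ ^ 2 + (S.β * S.τ) ^ 2 * ‖S.hat j.1 S.Y0‖ ^ 2 +
          (S.β * S.τ) ^ 2 * ‖S.hat j.1 S.Yt0‖ ^ 2) +
        4 * ((S.γ * S.τ) ^ 2 * ‖S.hat j.1 g‖ ^ 2) := by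
      intro j
      have h4 := norm_add_sq_le ((S.β * S.τ) • S.hat j.1 S.Y0) ((S.γ * S.τ) • S.hat j.1 g)
      have h5 := norm_sub_sq_le ((S.β * S.τ) • S.hat j.1 S.Yt0) ((S.γ * S.τ) • S.hat j.1 g)
      rw [hout, hin]
      have nsq : ∀ (c : ℝ) (v : Vec n), ‖c • v‖ ^ 2 = c ^ 2 * ‖v‖ ^ 2 := by
        intro c v
        rw [norm_smul, mul_pow, Real.norm_eq_abs, sq_abs]
      simp only [nsq] at h4 h5
      have h6 : (S.state B e 0).1 = S.x0 := rfl
      rw [h6]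
      nlinarith [sq_nonneg ‖S.hat j.1 S.x0‖]
    refine (Finset.sum_le_sum fun j _ => h3 j).trans ?_
    rw [Finset.sum_add_distrib, ← Finset.mul_sum, ← Finset.mul_sum, ← Finset.mul_sum]
    linarith
  rw [hlhs]
  refine (Finset.sum_le_sum fun j _ => hmode j).trans ?_
  rw [← Finset.mul_sum]
  refine mul_le_mul_of_nonneg_left ?_ hC.le
  rw [Finset.sum_add_distrib]
  exact add_le_add hinit hdrift

end

section

/-! ### Descent along a trajectory -/

variable {n : ℕ} (S : LTADMMDP n)
variable (B : ℕ → ℕ → (i : Fin S.N) → Finset (Fin (S.m i))) (e : ℕ → ℕ → Fin S.N → Vec n)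

/-- Deviation of the stochastic gradient of agent `i` from its local gradient. -/
def gradErr (k t : ℕ) (i : Fin S.N) : Vec n :=
  S.grad B e k t i - gradient (S.f i) (S.phi B e k t i)

/-- Bound for the squared drift of agent `i` in round `k`. -/
def driftBound (k : ℕ) (i : Fin S.N) : ℝ :=
  2 * (S.τ : ℝ) ^ 2 * S.ζ ^ 2 + 2 * S.τ * ∑ t ∈ Finset.range S.τ, ‖e k t i‖ ^ 2

theorem norm_mean_sq_le (v : Fin S.N → Vec n) :
    ‖S.mean v‖ ^ 2 ≤ (S.N : ℝ)⁻¹ * ∑ i, ‖v i‖ ^ 2 := by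
  have h := norm_sum_sq_le Finset.univ v
  rw [Finset.card_univ, Fintype.card_fin] at h
  rw [mean, norm_smul, mul_pow, Real.norm_eq_abs, sq_abs]
  rcases eq_or_ne (S.N : ℝ) 0 with h0 | h0
  · simp [h0]
  · refine (mul_le_mul_of_nonneg_left h (sq_nonneg _)).trans_eq ?_
    field_simp

theorem norm_drift_sq_le (hζ : 0 < S.ζ) {k t : ℕ} (ht : t ≤ S.τ) (i : Fin S.N) :
    ‖S.drift B e k t i‖ ^ 2 ≤ S.driftBound e k i := by
  have h1 := norm_sum_sq_le (Finset.range t) fun r => S.clip (S.grad B e k r i) + e k r i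
  rw [Finset.card_range] at h1
  have h2 : ∑ r ∈ Finset.range t, ‖S.clip (S.grad B e k r i) + e k r i‖ ^ 2 ≤
      ∑ r ∈ Finset.range S.τ, (2 * S.ζ ^ 2 + 2 * ‖e k r i‖ ^ 2) := by
    calc _ ≤ ∑ r ∈ Finset.range t, (2 * S.ζ ^ 2 + 2 * ‖e k r i‖ ^ 2) := by
          refine Finset.sum_le_sum fun r _ => (norm_add_sq_le _ _).trans ?_
          have := S.norm_clip_le hζ (S.grad B e k r i)
          gcongr
      _ ≤ _ := Finset.sum_le_sum_of_subset_of_nonneg (Finset.range_mono ht)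
          fun _ _ _ => by positivity
  have h3 : (t : ℝ) ≤ S.τ := by exact_mod_cast ht
  calc _ ≤ _ := h1
    _ ≤ S.τ * ∑ r ∈ Finset.range S.τ, (2 * S.ζ ^ 2 + 2 * ‖e k r i‖ ^ 2) :=
        mul_le_mul h3 h2 (Finset.sum_nonneg fun _ _ => by positivity) (by positivity)
    _ = _ := by
        simp only [driftBound, Finset.sum_add_distrib, ← Finset.mul_sum, Finset.sum_const,
          Finset.card_range, nsmul_eq_mul]
        ring

variable {L σf σg ll lu : ℝ} {xstar : Vec n}

/-- A local iterate differs from the average by the consensus error of its agent, a fraction `t/τ`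
of the full correction, and the drift so far; `driftBound` covers every `t ≤ τ`. -/
theorem sum_norm_phi_sub_xbar_sq_le (hA : S.Assumptions L σf σg ll lu xstar) (k : ℕ) :
    ∑ i, ∑ t ∈ Finset.range S.τ, ‖S.phi B e k t i - S.xbar B e k‖ ^ 2 ≤
      3 * S.τ * (S.consensusErr B e k + S.γ ^ 2 * ∑ i, S.driftBound e k i) := by
  have hβ := hA.β_pos
  have h : ∀ i, ∀ t ∈ Finset.range S.τ, ‖S.phi B e k t i - S.xbar B e k‖ ^ 2 ≤
      3 * (‖(S.state B e k).1 i - S.xbar B e k‖ ^ 2 + ‖(S.β * S.τ) • S.outY B e k i‖ ^ 2 +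
        S.γ ^ 2 * S.driftBound e k i) := by
    intro i t ht
    have ht' := (Finset.mem_range.mp ht).le
    have e1 : S.phi B e k t i - S.xbar B e k = ((S.state B e k).1 i - S.xbar B e k) +
        (t * S.β) • S.outY B e k i + (-S.γ) • S.drift B e k t i := by
      rw [phi_eq]; module
    rw [e1]
    refine (norm_add_three_sq_le _ _ _).trans ?_
    have h1 : ‖(t * S.β) • S.outY B e k i‖ ^ 2 ≤ ‖(S.β * S.τ) • S.outY B e k i‖ ^ 2 := by
      rw [norm_smul, norm_smul, Real.norm_of_nonneg (by positivity),
        Real.norm_of_nonneg (by positivity), mul_comm S.β]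
      gcongr
    have h2 : ‖(-S.γ) • S.drift B e k t i‖ ^ 2 ≤ S.γ ^ 2 * S.driftBound e k i := by
      rw [norm_smul, mul_pow, Real.norm_eq_abs, sq_abs, neg_sq]
      exact mul_le_mul_of_nonneg_left (S.norm_drift_sq_le B e hA.ζ_pos ht' i) (sq_nonneg _)
    linarith
  refine (Finset.sum_le_sum fun i _ => Finset.sum_le_sum (h i)).trans_eq ?_
  simp only [Finset.sum_const, Finset.card_range, nsmul_eq_mul, consensusErr, ← Finset.mul_sum,
    Finset.sum_add_distrib]
  ring

theorem norm_gradient_sub_sq_le (hA : S.Assumptions L σf σg ll lu xstar) (i : Fin S.N)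
    (x y : Vec n) :
    ‖gradient (S.f i) x - gradient S.F y‖ ^ 2 ≤ 2 * σf ^ 2 + 2 * L ^ 2 * ‖x - y‖ ^ 2 := by
  have e1 : gradient (S.f i) x - gradient S.F y =
      (gradient (S.f i) x - gradient (S.f i) y) - (gradient S.F y - gradient (S.f i) y) := by
    abel
  have h1 := pow_le_pow_left₀ (norm_nonneg _) (hA.smooth i x y) 2
  have h2 := pow_le_pow_left₀ (norm_nonneg _) (hA.variation i y) 2
  rw [e1]
  refine (norm_sub_sq_le _ _).trans ?_
  rw [mul_pow] at h1
  linarith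

/-- Total correlation of the gradient with the errors of the stochastic gradients in round `k`. -/
def errTerm (k : ℕ) : ℝ :=
  ∑ i, ∑ t ∈ Finset.range S.τ, ‖gradient S.F (S.xbar B e k)‖ * ‖S.gradErr B e k t i‖

/-- Total correlation of the gradient with the noise of round `k`. -/
def noiseTerm (k : ℕ) : ℝ :=
  ∑ i, ∑ t ∈ Finset.range S.τ, inner ℝ (gradient S.F (S.xbar B e k)) (e k t i)

/-- The descent inequality at the average, with every clipped gradient compared to `∇F(x̄)` by
`gap_le_inner_clip`. The factor `40` is `20 · 2` from splitting the local gradient error, and `120`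
is `40 · 3` from the three parts of `φ - x̄`. -/
theorem F_xbar_succ_le (hL : 0 < L) (hA : S.Assumptions L σf σg ll lu xstar) (k : ℕ) :
    S.F (S.xbar B e (k + 1)) + S.γ * S.τ * (S.gap σg (S.xbar B e k) +
        2 * σg * ‖gradient S.F (S.xbar B e k)‖) ≤
      S.F (S.xbar B e k) + S.γ * S.τ * (2 * σg * S.ζ + 40 * σf ^ 2) +
        120 * S.γ * S.τ * L ^ 2 * ((S.N : ℝ)⁻¹ * S.consensusErr B e k) +
        (120 * S.γ ^ 3 * S.τ * L ^ 2 + L * S.γ ^ 2) *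
          ((S.N : ℝ)⁻¹ * ∑ i, S.driftBound e k i) +
        2 * S.γ * (S.N : ℝ)⁻¹ * S.errTerm B e k - S.γ * (S.N : ℝ)⁻¹ * S.noiseTerm B e k := by
  have hN := hA.N_pos
  have hγ := hA.γ_pos
  set x := S.xbar B e k with hx
  set a := gradient S.F x with ha
  have hdesc := le_add_inner_gradient_add hA.differentiable_F hA.smooth_F hL.le x
    (S.xbar B e (k + 1))
  have hstep : S.xbar B e (k + 1) - x = (-S.γ) • S.mean (S.drift B e k S.τ) := by
    rw [S.xbar_succ B e hA, ← hx]; module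
  rw [hstep, ← ha] at hdesc
  have hsq : ‖(-S.γ) • S.mean (S.drift B e k S.τ)‖ ^ 2 ≤
      S.γ ^ 2 * ((S.N : ℝ)⁻¹ * ∑ i, S.driftBound e k i) := by
    rw [norm_smul, mul_pow, Real.norm_eq_abs, sq_abs, neg_sq]
    refine mul_le_mul_of_nonneg_left ((S.norm_mean_sq_le _).trans ?_) (sq_nonneg _)
    gcongr with i
    exact S.norm_drift_sq_le B e hA.ζ_pos le_rfl i
  have hinner : inner ℝ a ((-S.γ) • S.mean (S.drift B e k S.τ)) =
      -(S.γ * (S.N : ℝ)⁻¹ * ∑ i, ∑ t ∈ Finset.range S.τ, inner ℝ a (S.clip (S.grad B e k t i))) -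
        S.γ * (S.N : ℝ)⁻¹ * S.noiseTerm B e k := by
    simp only [mean, drift, noiseTerm, inner_smul_right, inner_sum, inner_add_right,
      Finset.sum_add_distrib, ← hx, ← ha]
    ring
  have hclip : ∑ i : Fin S.N, ∑ t ∈ Finset.range S.τ, (S.gap σg x + 2 * σg * ‖a‖) ≤
      ∑ i, ∑ t ∈ Finset.range S.τ, (inner ℝ a (S.clip (S.grad B e k t i)) +
        20 * (2 * σf ^ 2 + 2 * L ^ 2 * ‖S.phi B e k t i - x‖ ^ 2) +
          2 * (‖a‖ * ‖S.gradErr B e k t i‖) + 2 * σg * S.ζ) := by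
    refine Finset.sum_le_sum fun i _ => Finset.sum_le_sum fun t _ => ?_
    have h1 := S.gap_le_inner_clip hA.σg_pos.le hA.ζ_pos x
      (gradient (S.f i) (S.phi B e k t i)) (S.grad B e k t i)
    have h2 := S.norm_gradient_sub_sq_le hA i (S.phi B e k t i) x
    rw [gradErr]
    linarith
  have hphi := S.sum_norm_phi_sub_xbar_sq_le B e hA k
  simp only [Finset.sum_add_distrib, Finset.sum_const, Finset.card_univ, Fintype.card_fin,
    Finset.card_range, nsmul_eq_mul, ← Finset.mul_sum] at hclip
  rw [← hx] at hphi
  have herr : S.errTerm B e k = ‖a‖ * ∑ i, ∑ t ∈ Finset.range S.τ, ‖S.gradErr B e k t i‖ := by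
    simp only [errTerm, Finset.mul_sum, ← hx, ← ha]
  rw [← herr] at hclip
  set Sc := ∑ i, ∑ t ∈ Finset.range S.τ, inner ℝ a (S.clip (S.grad B e k t i))
  set Sp := ∑ i, ∑ t ∈ Finset.range S.τ, ‖S.phi B e k t i - x‖ ^ 2
  set U := ∑ i, S.driftBound e k i
  have h3 := mul_le_mul_of_nonneg_left hphi (by positivity : 0 ≤ 40 * L ^ 2)
  have h4 : S.N * (S.τ * (S.gap σg x + 2 * σg * ‖a‖)) ≤ Sc + 40 * σf ^ 2 * (S.N * S.τ) +
      120 * L ^ 2 * S.τ * (S.consensusErr B e k + S.γ ^ 2 * U) + 2 * S.errTerm B e k +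
        2 * σg * S.ζ * (S.N * S.τ) := by
    linarith
  have h5 := mul_le_mul_of_nonneg_left h4 (by positivity : 0 ≤ S.γ * (S.N : ℝ)⁻¹)
  have h6 := mul_le_mul_of_nonneg_left hsq hL.le
  have h7 : (S.N : ℝ)⁻¹ * S.N = 1 := inv_mul_cancel₀ hN.ne'
  have e1 : S.γ * (S.N : ℝ)⁻¹ * (S.N * (S.τ * (S.gap σg x + 2 * σg * ‖a‖))) =
      S.γ * S.τ * (S.gap σg x + 2 * σg * ‖a‖) := by
    linear_combination (S.γ * (S.τ * (S.gap σg x + 2 * σg * ‖a‖))) * h7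
  have e2 : S.γ * (S.N : ℝ)⁻¹ * (Sc + 40 * σf ^ 2 * (S.N * S.τ) +
      120 * L ^ 2 * S.τ * (S.consensusErr B e k + S.γ ^ 2 * U) + 2 * S.errTerm B e k +
        2 * σg * S.ζ * (S.N * S.τ)) = S.γ * (S.N : ℝ)⁻¹ * Sc +
      S.γ * S.τ * (2 * σg * S.ζ + 40 * σf ^ 2) +
        120 * S.γ * S.τ * L ^ 2 * ((S.N : ℝ)⁻¹ * S.consensusErr B e k) +
        120 * S.γ ^ 3 * S.τ * L ^ 2 * ((S.N : ℝ)⁻¹ * U) +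
        2 * S.γ * (S.N : ℝ)⁻¹ * S.errTerm B e k := by
    linear_combination (S.γ * S.τ * (2 * σg * S.ζ + 40 * σf ^ 2)) * h7
  rw [e1, e2] at h5
  rw [hinner] at hdesc
  linarith

/-- Pathwise form of the convergence estimate. -/
theorem sum_gap_le (hL : 0 < L) (hA : S.Assumptions L σf σg ll lu xstar) (K : ℕ) :
    S.γ * S.τ * ∑ k ∈ Finset.range K, (S.gap σg (S.xbar B e k) +
        2 * σg * ‖gradient S.F (S.xbar B e k)‖) ≤
      S.F (S.mean S.x0) - S.F xstar + K * (S.γ * S.τ * (2 * σg * S.ζ + 40 * σf ^ 2)) +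
        120 * S.γ * S.τ * L ^ 2 * ((S.N : ℝ)⁻¹ * ∑ k ∈ Finset.range K, S.consensusErr B e k) +
        (120 * S.γ ^ 3 * S.τ * L ^ 2 + L * S.γ ^ 2) *
          ((S.N : ℝ)⁻¹ * ∑ k ∈ Finset.range K, ∑ i, S.driftBound e k i) +
        2 * S.γ * (S.N : ℝ)⁻¹ * ∑ k ∈ Finset.range K, S.errTerm B e k -
        S.γ * (S.N : ℝ)⁻¹ * ∑ k ∈ Finset.range K, S.noiseTerm B e k := by
  have h := Finset.sum_le_sum fun k (_ : k ∈ Finset.range K) => S.F_xbar_succ_le B e hL hA k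
  have ht := Finset.sum_range_sub (fun k => S.F (S.xbar B e k)) K
  have hm := hA.minimizer (S.xbar B e K)
  have h0 : S.xbar B e 0 = S.mean S.x0 := rfl
  simp only [Finset.sum_add_distrib, Finset.sum_sub_distrib, ← Finset.mul_sum, Finset.sum_const,
    Finset.card_range, nsmul_eq_mul] at h ht ⊢
  rw [h0] at ht
  linarith

end

section

/-! ### Measurability of the trajectories -/

variable {n : ℕ} (S : LTADMMDP n)

theorem measurable_gradient (f : Vec n → ℝ) : Measurable (gradient f) :=
  (InnerProductSpace.toDual ℝ (Vec n)).symm.continuous.measurable.comp (measurable_fderiv ℝ f)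

theorem measurable_clip : Measurable S.clip := by
  unfold clip; fun_prop

theorem measurable_batchGrad (i : Fin S.N) :
    Measurable fun p : Vec n × Finset (Fin (S.m i)) => S.batchGrad i p.2 p.1 := by
  refine measurable_from_prod_countable_left fun b => ?_
  have h : Measurable fun x => ∑ h ∈ b, gradient (S.loss i h) x :=
    Finset.measurable_sum _ fun h _ => measurable_gradient (S.loss i h)
  simp only [batchGrad]
  fun_prop

section Measurability

variable {Ω : Type*} [MeasurableSpace Ω]
variable {B : ℕ → ℕ → (i : Fin S.N) → Ω → Finset (Fin (S.m i))} {e : ℕ → ℕ → Fin S.N → Ω → Vec n}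

theorem measurable_mean {v : Ω → Fin S.N → Vec n} (hv : ∀ i, Measurable fun ω => v ω i) :
    Measurable fun ω => S.mean (v ω) := by
  have h : Measurable fun ω => ∑ i, v ω i := Finset.measurable_sum _ fun i _ => hv i
  unfold mean
  fun_prop

theorem measurable_localTrain {x : Ω → Fin S.N → Vec n} {z : Ω → Fin S.N → Fin S.N → Vec n}
    {b : ℕ → (i : Fin S.N) → Ω → Finset (Fin (S.m i))} {w : ℕ → Fin S.N → Ω → Vec n}
    (hx : ∀ i, Measurable fun ω => x ω i) (hz : ∀ i j, Measurable fun ω => z ω i j) {t : ℕ}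
    (hb : ∀ r < t, ∀ i, Measurable (b r i)) (hw : ∀ r < t, ∀ i, Measurable (w r i))
    (i : Fin S.N) : Measurable fun ω =>
      S.localTrain (x ω) (z ω) (fun r i => b r i ω) (fun r i => w r i ω) t i := by
  induction t generalizing i with
  | zero => exact hx i
  | succ t ih =>
    have h1 := ih (fun r hr => hb r (hr.trans t.lt_succ_self))
      (fun r hr => hw r (hr.trans t.lt_succ_self)) i
    have h2 := S.measurable_clip.comp
      ((S.measurable_batchGrad i).comp (h1.prodMk (hb t t.lt_succ_self i)))
    have h3 : Measurable fun ω => ∑ j ∈ S.G.neighborFinset i, z ω i j :=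
      Finset.measurable_sum _ fun j _ => hz i j
    have h4 := hw t t.lt_succ_self i
    have h5 := hx i
    simp only [Function.comp_def] at h2
    simp only [localTrain]
    fun_prop

theorem measurable_state {k : ℕ}
    (hB : ∀ l < k, ∀ t < S.τ, ∀ i, Measurable (B l t i))
    (he : ∀ l < k, ∀ t < S.τ, ∀ i, Measurable (e l t i)) :
    (∀ i, Measurable fun ω =>
      (S.state (fun k t i => B k t i ω) (fun k t i => e k t i ω) k).1 i) ∧
    ∀ i j, Measurable fun ω =>
      (S.state (fun k t i => B k t i ω) (fun k t i => e k t i ω) k).2 i j := by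
  induction k with
  | zero => exact ⟨fun _ => measurable_const, fun _ _ => measurable_const⟩
  | succ k ih =>
    obtain ⟨h1, h2⟩ := ih (fun l hl => hB l (hl.trans k.lt_succ_self))
      (fun l hl => he l (hl.trans k.lt_succ_self))
    have h3 : ∀ i, Measurable fun ω =>
        (S.state (fun k t i => B k t i ω) (fun k t i => e k t i ω) (k + 1)).1 i := fun i =>
      S.measurable_localTrain h1 h2 (hB k k.lt_succ_self) (he k k.lt_succ_self) i
    have h4 : ∀ {u v w : Ω → Vec n}, Measurable u → Measurable v → Measurable w → Measurable
        fun ω => (1 / 2 : ℝ) • u ω - (1 / 2 : ℝ) • (v ω - (2 * S.ρ) • w ω) := by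
      intro u v w hu hv hw
      fun_prop
    exact ⟨h3, fun i j => h4 (h2 i j) (h2 j i) (h3 j)⟩

theorem measurable_xbar {k : ℕ}
    (hB : ∀ l < k, ∀ t < S.τ, ∀ i, Measurable (B l t i))
    (he : ∀ l < k, ∀ t < S.τ, ∀ i, Measurable (e l t i)) :
    Measurable fun ω => S.xbar (fun k t i => B k t i ω) (fun k t i => e k t i ω) k :=
  S.measurable_mean (S.measurable_state hB he).1

/-- Measurability is required only of draws made before step `t` of round `k`, so that the statement
also applies with `past` as the σ-algebra on `Ω`. -/
theorem measurable_phi {k t : ℕ} (ht : t ≤ S.τ)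
    (hB : ∀ l r, r < S.τ → l < k ∨ l = k ∧ r < t → ∀ i, Measurable (B l r i))
    (he : ∀ l r, r < S.τ → l < k ∨ l = k ∧ r < t → ∀ i, Measurable (e l r i)) (i : Fin S.N) :
    Measurable fun ω => S.phi (fun k t i => B k t i ω) (fun k t i => e k t i ω) k t i := by
  obtain ⟨h1, h2⟩ := S.measurable_state (k := k) (fun l hl r hr => hB l r hr (Or.inl hl))
    (fun l hl r hr => he l r hr (Or.inl hl))
  exact S.measurable_localTrain h1 h2
    (fun r hr => hB k r (hr.trans_le ht) (Or.inr ⟨rfl, hr⟩))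
    (fun r hr => he k r (hr.trans_le ht) (Or.inr ⟨rfl, hr⟩)) i

end Measurability

/-! ### Independence of the past -/

section Independence

variable {Ω : Type*}
variable {B : ℕ → ℕ → (i : Fin S.N) → Ω → Finset (Fin (S.m i))} {e : ℕ → ℕ → Fin S.N → Ω → Vec n}

variable (B e) in
/-- The draws made before local step `t` of round `k`. -/
@[reducible] def past (k t : ℕ) : MeasurableSpace Ω :=
  ⨆ p ∈ {p : ℕ × Fin S.τ × Fin S.N | p.1 < k ∨ p.1 = k ∧ (p.2.1 : ℕ) < t},
    MeasurableSpace.comap (fun ω => (B p.1 p.2.1 p.2.2 ω, e p.1 p.2.1 p.2.2 ω)) inferInstance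

theorem measurable_past {k t l r : ℕ} (hr : r < S.τ) (h : l < k ∨ l = k ∧ r < t) (i : Fin S.N) :
    Measurable[S.past B e k t] fun ω => (B l r i ω, e l r i ω) := by
  have h1 : MeasurableSpace.comap (fun ω => (B l r i ω, e l r i ω)) inferInstance ≤
      S.past B e k t :=
    le_iSup₂_of_le (f := fun (p : ℕ × Fin S.τ × Fin S.N) _ => MeasurableSpace.comap
      (fun ω => (B p.1 p.2.1 p.2.2 ω, e p.1 p.2.1 p.2.2 ω)) inferInstance)
      (l, ⟨r, hr⟩, i) h le_rfl
  exact (comap_measurable _).mono h1 le_rfl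

theorem measurable_past_xbar (k t : ℕ) : Measurable[S.past B e k t]
    fun ω => S.xbar (fun k t i => B k t i ω) (fun k t i => e k t i ω) k :=
  @measurable_xbar n S Ω (S.past B e k t) B e k
    (fun _ hl _ hr i => (S.measurable_past hr (Or.inl hl) i).fst)
    (fun _ hl _ hr i => (S.measurable_past hr (Or.inl hl) i).snd)

theorem measurable_past_phi {k t : ℕ} (ht : t < S.τ) (i : Fin S.N) :
    Measurable[S.past B e k t]
      fun ω => S.phi (fun k t i => B k t i ω) (fun k t i => e k t i ω) k t i :=
  @measurable_phi n S Ω (S.past B e k t) B e k t ht.le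
    (fun _ _ hr h i => (S.measurable_past hr h i).fst)
    (fun _ _ hr h i => (S.measurable_past hr h i).snd) i

variable [MeasurableSpace Ω] {P : Measure Ω}

/-- The draw `(k, t, i)` is not among the indices generating `past k t`, and σ-algebras generated by
disjoint families of independent draws are independent. -/
theorem IsDraw.indepFun_past (hD : S.IsDraw P B e) (hB : ∀ k t i, Measurable (B k t i))
    (he : ∀ k t i, Measurable (e k t i)) {α : Type*} [MeasurableSpace α] {X : Ω → α} {k t : ℕ}
    (hX : Measurable[S.past B e k t] X) (ht : t < S.τ) (i : Fin S.N) :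
    IndepFun X (fun ω => (B k t i ω, e k t i ω)) P := by
  have h := indep_iSup_of_disjoint (fun p => ((hB p.1 p.2.1 p.2.2).prodMk
      (he p.1 p.2.1 p.2.2)).comap_le) hD.indep.iIndep
    (S := {p : ℕ × Fin S.τ × Fin S.N | p.1 < k ∨ p.1 = k ∧ (p.2.1 : ℕ) < t})
    (T := {(k, ⟨t, ht⟩, i)}) (by simp)
  rw [IndepFun_iff_Indep]
  refine indep_of_indep_of_le_right (indep_of_indep_of_le_left h hX.comap_le) ?_
  exact le_iSup₂_of_le (f := fun (p : ℕ × Fin S.τ × Fin S.N) _ => MeasurableSpace.comap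
      (fun ω => (B p.1 p.2.1 p.2.2 ω, e p.1 p.2.1 p.2.2 ω)) inferInstance)
      (k, ⟨t, ht⟩, i) rfl le_rfl

end Independence

end

section

/-! ### Moments of the draws -/

variable {n : ℕ} (S : LTADMMDP n)

theorem lintegral_uniformOn {α : Type*} [MeasurableSpace α] [MeasurableSingletonClass α]
    (s : Finset α) (f : α → ENNReal) :
    ∫⁻ x, f x ∂(uniformOn (s : Set α)) = (s.card : ENNReal)⁻¹ * ∑ x ∈ s, f x := by
  rw [uniformOn, ProbabilityTheory.cond, lintegral_smul_measure, lintegral_finset,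
    Measure.count_apply_finset]
  simp

theorem integral_norm_sq_multivariateGaussian (σ : ℝ) :
    ∫ x, ‖x‖ ^ 2 ∂(multivariateGaussian (0 : Vec n)
      ((σ ^ 2) • (1 : Matrix (Fin n) (Fin n) ℝ))) = n * σ ^ 2 := by
  set μ := multivariateGaussian (0 : Vec n) ((σ ^ 2) • (1 : Matrix (Fin n) (Fin n) ℝ)) with hμ
  have hS : ((σ ^ 2) • (1 : Matrix (Fin n) (Fin n) ℝ)).PosSemidef :=
    Matrix.PosSemidef.one.smul (sq_nonneg σ)
  have h2 : MemLp (fun x : Vec n => x) 2 μ := IsGaussian.memLp_two_id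
  have hc : ∀ l, MemLp (fun x : Vec n => x l) 2 μ := fun l =>
    h2.of_le (by fun_prop) (Filter.Eventually.of_forall fun x => PiLp.norm_apply_le x l)
  have hm : ∀ l, ∫ x : Vec n, x l ∂μ = 0 := by
    intro l
    have := (EuclideanSpace.proj (𝕜 := ℝ) l).integral_comp_comm
      (h2.integrable (by norm_num) : Integrable (fun x : Vec n => x) μ)
    simpa [hμ, integral_id_multivariateGaussian] using this
  have hv : ∀ l, ∫ x : Vec n, (x l) ^ 2 ∂μ = σ ^ 2 := by
    intro l
    have h1 := variance_eval_multivariateGaussian (μ := (0 : Vec n)) hS l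
    rw [variance_of_integral_eq_zero (by fun_prop) (hm l)] at h1
    simpa using h1
  simp only [EuclideanSpace.norm_sq_eq, Real.norm_eq_abs, sq_abs]
  rw [integral_finsetSum _ fun l _ => (hc l).integrable_sq]
  simp [hv]

section Moments

variable {Ω : Type*} [mΩ : MeasurableSpace Ω] {P : Measure Ω}
variable {B : ℕ → ℕ → (i : Fin S.N) → Ω → Finset (Fin (S.m i))} {e : ℕ → ℕ → Fin S.N → Ω → Vec n}
variable {L σf σg ll lu : ℝ} {xstar : Vec n}

theorem IsDraw.memLp_noise (hD : S.IsDraw P B e) {k t : ℕ} (ht : t < S.τ) (i : Fin S.N) :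
    MemLp (e k t i) 2 P := by
  have h := hD.noise_law k t ht i
  have h2 : MemLp id 2 (P.map (e k t i)) := by
    rw [h.map_eq]; exact IsGaussian.memLp_two_id
  exact h2.comp_of_map h.aemeasurable

theorem IsDraw.integral_noise (hD : S.IsDraw P B e) {k t : ℕ} (ht : t < S.τ) (i : Fin S.N) :
    ∫ ω, e k t i ω ∂P = 0 := by
  rw [(hD.noise_law k t ht i).integral_eq, integral_id_multivariateGaussian]

theorem IsDraw.integral_norm_sq_noise (hD : S.IsDraw P B e) {k t : ℕ} (ht : t < S.τ)
    (i : Fin S.N) : ∫ ω, ‖e k t i ω‖ ^ 2 ∂P = n * S.σe ^ 2 := by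
  rw [← integral_norm_sq_multivariateGaussian, ← (hD.noise_law k t ht i).integral_comp]
  · rfl
  · fun_prop

theorem memLp_mean {v : Ω → Fin S.N → Vec n} (hv : ∀ i, MemLp (fun ω => v ω i) 2 P) :
    MemLp (fun ω => S.mean (v ω)) 2 P :=
  (memLp_finsetSum Finset.univ fun i _ => hv i).const_smul (S.N : ℝ)⁻¹

variable [IsProbabilityMeasure P]

/-- Mean of a function of a uniform draw, weighted by a factor independent of the draw. -/
theorem integrable_mul_of_hasLaw_uniformOn {𝓧 α : Type*} [MeasurableSpace 𝓧] [MeasurableSpace α]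
    [MeasurableSingletonClass α] {s : Finset α} (hs : s.Nonempty) {g : 𝓧 → α → ℝ}
    (hg : Measurable (Function.uncurry g)) (hg0 : ∀ x c, 0 ≤ g x c) {σ : ℝ} (hσ : 0 ≤ σ)
    (havg : ∀ x, (s.card : ℝ)⁻¹ * ∑ c ∈ s, g x c ≤ σ)
    {w : Ω → ℝ} {x : Ω → 𝓧} {b : Ω → α} (hw : Measurable w)
    (hw0 : ∀ ω, 0 ≤ w ω) (hx : Measurable x) (hb : Measurable b) (hint : Integrable w P)
    (hlaw : HasLaw b (uniformOn (s : Set α)) P) (hind : IndepFun (fun ω => (w ω, x ω)) b P) :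
    Integrable (fun ω => w ω * g (x ω) (b ω)) P ∧
      ∫ ω, w ω * g (x ω) (b ω) ∂P ≤ σ * ∫ ω, w ω ∂P := by
  have hmeas : Measurable fun ω => w ω * g (x ω) (b ω) := hw.mul (hg.comp (hx.prodMk hb))
  have hnn : ∀ ω, 0 ≤ w ω * g (x ω) (b ω) := fun ω => mul_nonneg (hw0 ω) (hg0 _ _)
  have hG : Measurable fun p : (ℝ × 𝓧) × α => ENNReal.ofReal (p.1.1 * g p.1.2 p.2) :=
    ((measurable_fst.comp measurable_fst).mul
      (hg.comp ((measurable_snd.comp measurable_fst).prodMk measurable_snd))).ennreal_ofReal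
  -- Everything is nonnegative, so Tonelli on the product law gives the bound in `ENNReal` first;
  -- integrability then follows from it.
  have hkey : ∫⁻ ω, ENNReal.ofReal (w ω * g (x ω) (b ω)) ∂P ≤
      ENNReal.ofReal σ * ∫⁻ ω, ENNReal.ofReal (w ω) ∂P := by
    have h1 := hind.map_prod_eq_prod_map_map (hw.prodMk hx).aemeasurable hb.aemeasurable
    rw [hlaw.map_eq] at h1
    have hfin : IsFiniteMeasure (uniformOn (s : Set α)) := by
      rw [← hlaw.map_eq]; exact Measure.isFiniteMeasure_map P b
    calc _ = ∫⁻ p, ENNReal.ofReal (p.1.1 * g p.1.2 p.2) ∂(P.map fun ω => ((w ω, x ω), b ω)) := by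
          rw [lintegral_map hG ((hw.prodMk hx).prodMk hb)]
      _ = ∫⁻ y, ∫⁻ c, ENNReal.ofReal (y.1 * g y.2 c) ∂(uniformOn (s : Set α))
            ∂(P.map fun ω => (w ω, x ω)) := by
          rw [h1, lintegral_prod _ hG.aemeasurable]
      _ = ∫⁻ ω, ∫⁻ c, ENNReal.ofReal (w ω * g (x ω) c) ∂(uniformOn (s : Set α)) ∂P := by
          rw [lintegral_map hG.lintegral_prod_right' (hw.prodMk hx)]
      _ ≤ ∫⁻ ω, ENNReal.ofReal σ * ENNReal.ofReal (w ω) ∂P := by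
          refine lintegral_mono fun ω => ?_
          rw [lintegral_uniformOn, ← ENNReal.ofReal_sum_of_nonneg
            fun c _ => mul_nonneg (hw0 ω) (hg0 _ _), ← Finset.mul_sum]
          have hc : (0 : ℝ) < s.card := by exact_mod_cast hs.card_pos
          rw [← ENNReal.ofReal_natCast, ← ENNReal.ofReal_inv_of_pos hc,
            ← ENNReal.ofReal_mul (by positivity), ← ENNReal.ofReal_mul hσ]
          refine ENNReal.ofReal_le_ofReal ?_
          have := mul_le_mul_of_nonneg_right (havg (x ω)) (hw0 ω)
          linarith
      _ = _ := lintegral_const_mul _ hw.ennreal_ofReal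
  have hfinw : ∫⁻ ω, ENNReal.ofReal (w ω) ∂P = ENNReal.ofReal (∫ ω, w ω ∂P) :=
    (ofReal_integral_eq_lintegral_ofReal hint (Filter.Eventually.of_forall hw0)).symm
  rw [hfinw, ← ENNReal.ofReal_mul hσ] at hkey
  have hI : Integrable (fun ω => w ω * g (x ω) (b ω)) P := by
    refine ⟨hmeas.aestronglyMeasurable, ?_⟩
    rw [hasFiniteIntegral_iff_ofReal (Filter.Eventually.of_forall hnn)]
    exact hkey.trans_lt ENNReal.ofReal_lt_top
  refine ⟨hI, ?_⟩
  rw [← ofReal_integral_eq_lintegral_ofReal hI (Filter.Eventually.of_forall hnn)] at hkey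
  exact (ENNReal.ofReal_le_ofReal_iff (mul_nonneg hσ (integral_nonneg hw0))).mp hkey

theorem memLp_gradient (hA : S.Assumptions L σf σg ll lu xstar) {x : Ω → Vec n}
    (hm : Measurable x) (hx : MemLp x 2 P) : MemLp (fun ω => gradient S.F (x ω)) 2 P := by
  have h0 : MemLp (fun ω => L * ‖x ω‖) 2 P := hx.norm.const_mul L
  have h1 : MemLp (fun _ : Ω => ‖gradient S.F 0‖) 2 P := memLp_const _
  have h2 : MemLp (fun ω => ‖gradient S.F 0‖ + L * ‖x ω‖) 2 P := h1.add h0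
  refine h2.mono' ((measurable_gradient S.F).comp hm).aestronglyMeasurable
    (Filter.Eventually.of_forall fun ω => ?_)
  have h3 := hA.smooth_F (x ω) 0
  have h4 := norm_sub_norm_le (gradient S.F (x ω)) (gradient S.F 0)
  rw [sub_zero] at h3
  linarith

theorem measurable_gap (σg : ℝ) : Measurable (S.gap σg) := by
  have h := (measurable_gradient S.F).norm
  exact Measurable.ite (measurableSet_le measurable_const h) (h.const_mul _)
    ((h.pow_const 2).const_mul _)

theorem integrable_gap_comp (hA : S.Assumptions L σf σg ll lu xstar) {x : Ω → Vec n}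
    (hm : Measurable x) (hx : MemLp x 2 P) : Integrable (fun ω => S.gap σg (x ω)) P := by
  have h1 := (S.memLp_gradient hA hm hx).norm
  have h2 := (h1.integrable_sq).add ((h1.integrable (by norm_num)).const_mul S.ζ)
  refine h2.mono' ((S.measurable_gap σg).comp hm).aestronglyMeasurable
    (Filter.Eventually.of_forall fun ω => ?_)
  have hζ := hA.ζ_large
  have hσ := hA.σg_pos
  simp only [gap, Pi.add_apply]
  set a := ‖gradient S.F (x ω)‖ with ha
  have ha0 : 0 ≤ a := norm_nonneg _
  split_ifs
  · rw [Real.norm_of_nonneg (mul_nonneg (by linarith) ha0)]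
    nlinarith [mul_nonneg hσ.le ha0, mul_nonneg hA.ζ_pos.le ha0]
  · rw [Real.norm_of_nonneg (by positivity)]
    nlinarith [mul_nonneg hA.ζ_pos.le ha0]

/-- Clipped gradients are bounded and the noise is Gaussian, so each round adds a square integrable
increment to the average. -/
theorem memLp_xbar (hA : S.Assumptions L σf σg ll lu xstar) (hD : S.IsDraw P B e)
    (hB : ∀ k t i, Measurable (B k t i)) (he : ∀ k t i, Measurable (e k t i)) (k : ℕ) :
    MemLp (fun ω => S.xbar (fun k t i => B k t i ω) (fun k t i => e k t i ω) k) 2 P := by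
  induction k with
  | zero => exact memLp_const (S.mean S.x0)
  | succ k ih =>
    have h : ∀ i, MemLp (fun ω =>
        S.drift (fun k t i => B k t i ω) (fun k t i => e k t i ω) k S.τ i) 2 P := by
      intro i
      refine memLp_finsetSum _ fun t ht => ?_
      have ht' := Finset.mem_range.mp ht
      refine MemLp.add (MemLp.of_bound (C := S.ζ) ?_
        (Filter.Eventually.of_forall fun ω => S.norm_clip_le hA.ζ_pos _))
        (hD.memLp_noise S ht' i)
      exact (S.measurable_clip.comp ((S.measurable_batchGrad i).comp
        ((S.measurable_phi ht'.le (fun _ _ _ _ _ => hB _ _ _) (fun _ _ _ _ _ => he _ _ _) i).prodMk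
          (hB k t i)))).aestronglyMeasurable
    simp only [S.xbar_succ _ _ hA]
    exact ih.sub ((S.memLp_mean h).const_smul S.γ)

theorem memLp_gradient_xbar (hA : S.Assumptions L σf σg ll lu xstar) (hD : S.IsDraw P B e)
    (hB : ∀ k t i, Measurable (B k t i)) (he : ∀ k t i, Measurable (e k t i)) (k : ℕ) :
    MemLp (fun ω => gradient S.F (S.xbar (fun k t i => B k t i ω) (fun k t i => e k t i ω) k))
      2 P :=
  S.memLp_gradient hA (S.measurable_xbar (fun _ _ _ _ _ => hB _ _ _) (fun _ _ _ _ _ => he _ _ _))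
    (S.memLp_xbar hA hD hB he k)

theorem integrable_gap (hA : S.Assumptions L σf σg ll lu xstar) (hD : S.IsDraw P B e)
    (hB : ∀ k t i, Measurable (B k t i)) (he : ∀ k t i, Measurable (e k t i)) (k : ℕ) :
    Integrable (fun ω => S.gap σg (S.xbar (fun k t i => B k t i ω) (fun k t i => e k t i ω) k))
      P :=
  S.integrable_gap_comp hA
    (S.measurable_xbar (fun _ _ _ _ _ => hB _ _ _) (fun _ _ _ _ _ => he _ _ _))
    (S.memLp_xbar hA hD hB he k)

theorem batches_nonempty (hA : S.Assumptions L σf σg ll lu xstar) (i : Fin S.N) :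
    (S.batches i).Nonempty := by
  rw [← Finset.card_pos, batches, Finset.card_powersetCard, Finset.card_univ, Fintype.card_fin]
  exact Nat.choose_pos (hA.batch_size i).2.le

theorem measurable_batchGrad_deviation (i : Fin S.N) :
    Measurable (Function.uncurry fun (x : Vec n) (b : Finset (Fin (S.m i))) =>
      ‖S.batchGrad i b x - gradient (S.f i) x‖) :=
  ((S.measurable_batchGrad i).sub ((measurable_gradient (S.f i)).comp measurable_fst)).norm

/-- Both `x̄_k` and the point `φ` are determined by the past, while the batch is fresh. Averaging
over the batch first replaces its deviation by `σg`. -/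
theorem integrable_errTerm (hA : S.Assumptions L σf σg ll lu xstar) (hD : S.IsDraw P B e)
    (hB : ∀ k t i, Measurable (B k t i)) (he : ∀ k t i, Measurable (e k t i)) (k : ℕ) :
    Integrable (fun ω => S.errTerm (fun k t i => B k t i ω) (fun k t i => e k t i ω) k) P ∧
      ∫ ω, S.errTerm (fun k t i => B k t i ω) (fun k t i => e k t i ω) k ∂P ≤ S.N * S.τ * (σg *
        ∫ ω, ‖gradient S.F (S.xbar (fun k t i => B k t i ω) (fun k t i => e k t i ω) k)‖ ∂P) := by
  have h : ∀ i, ∀ t ∈ Finset.range S.τ, Integrable (fun ω =>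
      ‖gradient S.F (S.xbar (fun k t i => B k t i ω) (fun k t i => e k t i ω) k)‖ *
        ‖S.gradErr (fun k t i => B k t i ω) (fun k t i => e k t i ω) k t i‖) P ∧
      ∫ ω, ‖gradient S.F (S.xbar (fun k t i => B k t i ω) (fun k t i => e k t i ω) k)‖ *
        ‖S.gradErr (fun k t i => B k t i ω) (fun k t i => e k t i ω) k t i‖ ∂P ≤ σg *
      ∫ ω, ‖gradient S.F (S.xbar (fun k t i => B k t i ω) (fun k t i => e k t i ω) k)‖ ∂P := by
    intro i t ht
    have ht' := Finset.mem_range.mp ht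
    have hind := (hD.indepFun_past S hB he (X := fun ω =>
        (‖gradient S.F (S.xbar (fun k t i => B k t i ω) (fun k t i => e k t i ω) k)‖,
          S.phi (fun k t i => B k t i ω) (fun k t i => e k t i ω) k t i))
        (Measurable.prodMk
          ((measurable_gradient S.F).norm.comp (S.measurable_past_xbar k t))
          (S.measurable_past_phi ht' i)) ht' i).comp measurable_id measurable_fst
    exact integrable_mul_of_hasLaw_uniformOn (S.batches_nonempty hA i)
      (S.measurable_batchGrad_deviation i) (fun _ _ => norm_nonneg _) hA.σg_pos.le
      (hA.deviation i)
      ((measurable_gradient S.F).norm.comp (S.measurable_xbar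
        (fun _ _ _ _ _ => hB _ _ _) (fun _ _ _ _ _ => he _ _ _)))
      (fun _ => norm_nonneg _)
      (S.measurable_phi ht'.le (fun _ _ _ _ _ => hB _ _ _) (fun _ _ _ _ _ => he _ _ _) i)
      (hB k t i) ((S.memLp_gradient_xbar hA hD hB he k).norm.integrable (by norm_num))
      (hD.batch_law k t ht' i) hind
  refine ⟨integrable_finsetSum _ fun i _ => integrable_finsetSum _ fun t ht => (h i t ht).1, ?_⟩
  simp only [errTerm]
  rw [integral_finsetSum _ fun i _ => integrable_finsetSum _ fun t ht => (h i t ht).1]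
  calc _ ≤ ∑ i : Fin S.N, ∑ t ∈ Finset.range S.τ, (σg *
        ∫ ω, ‖gradient S.F (S.xbar (fun k t i => B k t i ω) (fun k t i => e k t i ω) k)‖ ∂P) := by
        refine Finset.sum_le_sum fun i _ => ?_
        rw [integral_finsetSum _ fun t ht => (h i t ht).1]
        exact Finset.sum_le_sum fun t ht => (h i t ht).2
    _ = _ := by simp [mul_assoc]

theorem integrable_noiseTerm (hA : S.Assumptions L σf σg ll lu xstar) (hD : S.IsDraw P B e)
    (hB : ∀ k t i, Measurable (B k t i)) (he : ∀ k t i, Measurable (e k t i)) (k : ℕ) :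
    Integrable (fun ω => S.noiseTerm (fun k t i => B k t i ω) (fun k t i => e k t i ω) k) P ∧
      ∫ ω, S.noiseTerm (fun k t i => B k t i ω) (fun k t i => e k t i ω) k ∂P = 0 := by
  have ha := S.memLp_gradient_xbar hA hD hB he k
  have h : ∀ i, ∀ t ∈ Finset.range S.τ, Integrable (fun ω => inner ℝ
      (gradient S.F (S.xbar (fun k t i => B k t i ω) (fun k t i => e k t i ω) k)) (e k t i ω)) P ∧
      ∫ ω, inner ℝ (gradient S.F (S.xbar (fun k t i => B k t i ω) (fun k t i => e k t i ω) k))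
        (e k t i ω) ∂P = 0 := by
    intro i t ht
    have ht' := Finset.mem_range.mp ht
    have hn := hD.memLp_noise S (k := k) ht' i
    have hind : IndepFun (fun ω =>
        gradient S.F (S.xbar (fun k t i => B k t i ω) (fun k t i => e k t i ω) k)) (e k t i) P :=
      (hD.indepFun_past S hB he (X := fun ω =>
        gradient S.F (S.xbar (fun k t i => B k t i ω) (fun k t i => e k t i ω) k))
        ((measurable_gradient S.F).comp (S.measurable_past_xbar k t)) ht' i).comp
        measurable_id measurable_snd
    have hi1 := ha.integrable (by norm_num : (1 : ENNReal) ≤ 2)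
    have hi2 := hn.integrable (by norm_num : (1 : ENNReal) ≤ 2)
    refine ⟨hind.integrable_bilin hi1 hi2 (innerSL ℝ), ?_⟩
    have := hind.integral_bilin hi1 hi2 (innerSL ℝ)
    rw [hD.integral_noise S ht' i, map_zero] at this
    exact this
  refine ⟨integrable_finsetSum _ fun i _ => integrable_finsetSum _ fun t ht => (h i t ht).1, ?_⟩
  simp only [noiseTerm]
  rw [integral_finsetSum _ fun i _ => integrable_finsetSum _ fun t ht => (h i t ht).1]
  refine Finset.sum_eq_zero fun i _ => ?_
  rw [integral_finsetSum _ fun t ht => (h i t ht).1]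
  exact Finset.sum_eq_zero fun t ht => (h i t ht).2

theorem integrable_driftBound (hD : S.IsDraw P B e) (k : ℕ) (i : Fin S.N) :
    Integrable (fun ω => S.driftBound (fun k t i => e k t i ω) k i) P ∧
      ∫ ω, S.driftBound (fun k t i => e k t i ω) k i ∂P =
        2 * (S.τ : ℝ) ^ 2 * (S.ζ ^ 2 + n * S.σe ^ 2) := by
  have h1 : ∀ t ∈ Finset.range S.τ, Integrable (fun ω => ‖e k t i ω‖ ^ 2) P := fun t ht =>
    (hD.memLp_noise S (Finset.mem_range.mp ht) i).norm.integrable_sq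
  have h2 := (integrable_finsetSum _ h1).const_mul (2 * (S.τ : ℝ))
  refine ⟨(integrable_const _).add h2, ?_⟩
  have h3 : ∫ ω, ∑ t ∈ Finset.range S.τ, ‖e k t i ω‖ ^ 2 ∂P = S.τ * (n * S.σe ^ 2) := by
    rw [integral_finsetSum _ h1, Finset.sum_congr rfl fun t ht =>
      hD.integral_norm_sq_noise S (k := k) (Finset.mem_range.mp ht) i]
    simp
  simp only [driftBound]
  rw [integral_add (integrable_const _) h2, integral_const_mul (2 * (S.τ : ℝ)), h3,
    integral_const, probReal_univ, one_smul]
  ring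

end Moments

end

section

/-! ### The convergence estimate -/

/-- Constant of the convergence estimate for `β τ ρ = b` and `γ τ ≤ g`. -/
def rateConst (n : ℕ) (b g L ll lu : ℝ) : ℝ :=
  1 + (42 + 480 * L ^ 2 * consensusConst (b * ll) (b * lu) * g ^ 2) +
    2160 * L ^ 2 * consensusConst (b * ll) (b * lu) * (1 + 2 / (b * ll)) * b ^ 2 +
    (240 * L ^ 2 * (1 + consensusConst (b * ll) (b * lu)) * g + 2 * L) * (n + 1)

theorem rateConst_pos {n : ℕ} {b g L ll lu : ℝ} (hb : 0 < b) (hg : 0 ≤ g) (hL : 0 < L)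
    (hll : 0 < ll) (hlu : b * lu < 2) : 0 < rateConst n b g L ll lu := by
  have := consensusConst_pos (mul_pos hb hll) hlu
  unfold rateConst
  positivity

variable {n : ℕ} (S : LTADMMDP n)
variable {L σf σg ll lu : ℝ} {xstar : Vec n}

theorem d0NormSq_nonneg : 0 ≤ S.d0NormSq :=
  Finset.sum_nonneg fun _ _ => Finset.sum_nonneg fun _ _ => by positivity

/-- Pathwise estimate with the consensus error eliminated. -/
theorem sum_gap_le_of_consensus (hL : 0 < L) (hA : S.Assumptions L σf σg ll lu xstar)
    (B : ℕ → ℕ → (i : Fin S.N) → Finset (Fin (S.m i))) (e : ℕ → ℕ → Fin S.N → Vec n) (K : ℕ) :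
    S.γ * S.τ * ∑ k ∈ Finset.range K, (S.gap σg (S.xbar B e k) +
        2 * σg * ‖gradient S.F (S.xbar B e k)‖) ≤
      S.F (S.mean S.x0) - S.F xstar + K * (S.γ * S.τ * (2 * σg * S.ζ + 40 * σf ^ 2)) +
        120 * S.γ * S.τ * L ^ 2 *
          consensusConst (S.β * S.τ * S.ρ * ll) (S.β * S.τ * S.ρ * lu) *
          (18 * (1 + 2 / (S.β * S.τ * S.ρ * ll)) * (S.β * S.τ) ^ 2 * (S.d0NormSq / S.N) +
            4 * (S.γ * S.τ) ^ 2 * σf ^ 2) +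
        (120 * S.γ ^ 3 * S.τ * L ^ 2 *
            (1 + consensusConst (S.β * S.τ * S.ρ * ll) (S.β * S.τ * S.ρ * lu)) + L * S.γ ^ 2) *
          ((S.N : ℝ)⁻¹ * ∑ k ∈ Finset.range K, ∑ i, S.driftBound e k i) +
        2 * S.γ * (S.N : ℝ)⁻¹ * ∑ k ∈ Finset.range K, S.errTerm B e k -
        S.γ * (S.N : ℝ)⁻¹ * ∑ k ∈ Finset.range K, S.noiseTerm B e k := by
  have hN := hA.N_pos
  have hγ := hA.γ_pos
  have hα : 0 < S.β * S.τ * S.ρ * ll := by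
    have := hA.β_pos
    have := hA.τ_pos'
    have := hA.ρ_pos
    have := hA.ll_pos
    positivity
  have hC := consensusConst_pos hα hA.mul_lu_lt_two
  have h1 := S.sum_gap_le B e hL hA K
  have h2 := S.sum_consensusErr_le B e hA K
  have h3 : ∑ k ∈ Finset.range K, ∑ i, ‖S.drift B e k S.τ i‖ ^ 2 ≤
      ∑ k ∈ Finset.range K, ∑ i, S.driftBound e k i :=
    Finset.sum_le_sum fun k _ => Finset.sum_le_sum fun i _ =>
      S.norm_drift_sq_le B e hA.ζ_pos le_rfl i
  set Cc := consensusConst (S.β * S.τ * S.ρ * ll) (S.β * S.τ * S.ρ * lu)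
  set U := ∑ k ∈ Finset.range K, ∑ i, S.driftBound e k i
  have h4 := mul_le_mul_of_nonneg_left h3 (by positivity : 0 ≤ Cc * S.γ ^ 2)
  have h5 : ∑ k ∈ Finset.range K, S.consensusErr B e k ≤
      Cc * (18 * (1 + 2 / (S.β * S.τ * S.ρ * ll)) * (S.β * S.τ) ^ 2 * S.d0NormSq +
          4 * (S.γ * S.τ) ^ 2 * S.N * σf ^ 2 + S.γ ^ 2 * U) := by
    linarith
  have h6 := mul_le_mul_of_nonneg_left h5
    (by positivity : 0 ≤ 120 * S.γ * S.τ * L ^ 2 * (S.N : ℝ)⁻¹)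
  have h7 : (S.N : ℝ)⁻¹ * S.N = 1 := inv_mul_cancel₀ hN.ne'
  have e1 : 120 * S.γ * S.τ * L ^ 2 * (S.N : ℝ)⁻¹ *
      (Cc * (18 * (1 + 2 / (S.β * S.τ * S.ρ * ll)) * (S.β * S.τ) ^ 2 * S.d0NormSq +
          4 * (S.γ * S.τ) ^ 2 * S.N * σf ^ 2 + S.γ ^ 2 * U)) =
      120 * S.γ * S.τ * L ^ 2 * Cc *
          (18 * (1 + 2 / (S.β * S.τ * S.ρ * ll)) * (S.β * S.τ) ^ 2 * (S.d0NormSq / S.N) +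
            4 * (S.γ * S.τ) ^ 2 * σf ^ 2) +
        120 * S.γ ^ 3 * S.τ * L ^ 2 * Cc * ((S.N : ℝ)⁻¹ * U) := by
    rw [div_eq_mul_inv]
    linear_combination (120 * S.γ * S.τ * L ^ 2 * Cc * 4 * (S.γ * S.τ) ^ 2 * σf ^ 2) * h7
  rw [e1] at h6
  linarith

section Expectation

variable {Ω : Type*} [mΩ : MeasurableSpace Ω] {P : Measure Ω} [IsProbabilityMeasure P]
variable {B : ℕ → ℕ → (i : Fin S.N) → Ω → Finset (Fin (S.m i))} {e : ℕ → ℕ → Fin S.N → Ω → Vec n}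

theorem sum_integral_gap_le (hL : 0 < L) (hA : S.Assumptions L σf σg ll lu xstar)
    (hD : S.IsDraw P B e) (hB : ∀ k t i, Measurable (B k t i))
    (he : ∀ k t i, Measurable (e k t i)) (K : ℕ) :
    S.γ * S.τ * ∑ k ∈ Finset.range K,
        ∫ ω, S.gap σg (S.xbar (fun k t i => B k t i ω) (fun k t i => e k t i ω) k) ∂P ≤
      S.F (S.mean S.x0) - S.F xstar + K * (S.γ * S.τ * (2 * σg * S.ζ + 40 * σf ^ 2)) +
        120 * S.γ * S.τ * L ^ 2 *
          consensusConst (S.β * S.τ * S.ρ * ll) (S.β * S.τ * S.ρ * lu) *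
          (18 * (1 + 2 / (S.β * S.τ * S.ρ * ll)) * (S.β * S.τ) ^ 2 * (S.d0NormSq / S.N) +
            4 * (S.γ * S.τ) ^ 2 * σf ^ 2) +
        (120 * S.γ ^ 3 * S.τ * L ^ 2 *
            (1 + consensusConst (S.β * S.τ * S.ρ * ll) (S.β * S.τ * S.ρ * lu)) + L * S.γ ^ 2) *
          (K * (2 * (S.τ : ℝ) ^ 2 * (S.ζ ^ 2 + n * S.σe ^ 2))) := by
  have hN := hA.N_pos
  have hγ := hA.γ_pos
  set A₀ : ℝ := S.F (S.mean S.x0) - S.F xstar +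
    K * (S.γ * S.τ * (2 * σg * S.ζ + 40 * σf ^ 2)) +
        120 * S.γ * S.τ * L ^ 2 *
          consensusConst (S.β * S.τ * S.ρ * ll) (S.β * S.τ * S.ρ * lu) *
          (18 * (1 + 2 / (S.β * S.τ * S.ρ * ll)) * (S.β * S.τ) ^ 2 * (S.d0NormSq / S.N) +
            4 * (S.γ * S.τ) ^ 2 * σf ^ 2) with hA₀
  set A₁ : ℝ := 120 * S.γ ^ 3 * S.τ * L ^ 2 *
    (1 + consensusConst (S.β * S.τ * S.ρ * ll) (S.β * S.τ * S.ρ * lu)) + L * S.γ ^ 2 with hA₁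
  let G : Ω → ℕ → ℝ := fun ω k =>
    S.gap σg (S.xbar (fun k t i => B k t i ω) (fun k t i => e k t i ω) k)
  let M : Ω → ℕ → ℝ := fun ω k =>
    ‖gradient S.F (S.xbar (fun k t i => B k t i ω) (fun k t i => e k t i ω) k)‖
  let U : Ω → ℕ → ℝ := fun ω k => ∑ i, S.driftBound (fun k t i => e k t i ω) k i
  let R : Ω → ℕ → ℝ := fun ω k =>
    S.errTerm (fun k t i => B k t i ω) (fun k t i => e k t i ω) k
  let W : Ω → ℕ → ℝ := fun ω k =>
    S.noiseTerm (fun k t i => B k t i ω) (fun k t i => e k t i ω) k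
  have iG : ∀ k, Integrable (fun ω => G ω k) P := fun k => S.integrable_gap hA hD hB he k
  have iM : ∀ k, Integrable (fun ω => M ω k) P := fun k =>
    (S.memLp_gradient_xbar hA hD hB he k).norm.integrable (by norm_num)
  have iU : ∀ k, Integrable (fun ω => U ω k) P := fun k =>
    integrable_finsetSum _ fun i _ => (S.integrable_driftBound hD k i).1
  have iR : ∀ k, Integrable (fun ω => R ω k) P := fun k => (S.integrable_errTerm hA hD hB he k).1
  have iW : ∀ k, Integrable (fun ω => W ω k) P := fun k =>
    (S.integrable_noiseTerm hA hD hB he k).1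
  have hpath : ∀ ω, S.γ * S.τ * ∑ k ∈ Finset.range K, (G ω k + 2 * σg * M ω k) ≤
      A₀ + A₁ * ((S.N : ℝ)⁻¹ * ∑ k ∈ Finset.range K, U ω k) +
        2 * S.γ * (S.N : ℝ)⁻¹ * ∑ k ∈ Finset.range K, R ω k -
        S.γ * (S.N : ℝ)⁻¹ * ∑ k ∈ Finset.range K, W ω k := fun ω =>
    S.sum_gap_le_of_consensus hL hA (fun k t i => B k t i ω) (fun k t i => e k t i ω) K
  have eU : ∀ k, ∫ ω, U ω k ∂P = S.N * (2 * (S.τ : ℝ) ^ 2 * (S.ζ ^ 2 + n * S.σe ^ 2)) := by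
    intro k
    change ∫ ω, ∑ i, S.driftBound (fun k t i => e k t i ω) k i ∂P = _
    rw [integral_finsetSum _ fun i _ => (S.integrable_driftBound hD k i).1,
      Finset.sum_congr rfl fun i _ => (S.integrable_driftBound hD k i).2]
    simp
  have eR : ∀ k, ∫ ω, R ω k ∂P ≤ S.N * S.τ * (σg * ∫ ω, M ω k ∂P) := fun k =>
    (S.integrable_errTerm hA hD hB he k).2
  have eW : ∀ k, ∫ ω, W ω k ∂P = 0 := fun k => (S.integrable_noiseTerm hA hD hB he k).2
  change S.γ * S.τ * ∑ k ∈ Finset.range K, ∫ ω, G ω k ∂P ≤ A₀ + A₁ *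
    (K * (2 * (S.τ : ℝ) ^ 2 * (S.ζ ^ 2 + n * S.σe ^ 2)))
  clear_value G M U R W
  have jGM : ∀ k, Integrable (fun ω => G ω k + 2 * σg * M ω k) P := fun k =>
    (iG k).add ((iM k).const_mul _)
  have iGM : Integrable (fun ω => S.γ * S.τ * ∑ k ∈ Finset.range K,
      (G ω k + 2 * σg * M ω k)) P :=
    (integrable_finsetSum _ fun k _ => jGM k).const_mul _
  have jU : Integrable (fun ω => A₁ * ((S.N : ℝ)⁻¹ * ∑ k ∈ Finset.range K, U ω k)) P :=
    ((integrable_finsetSum _ fun k _ => iU k).const_mul _).const_mul _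
  have jR : Integrable (fun ω => 2 * S.γ * (S.N : ℝ)⁻¹ * ∑ k ∈ Finset.range K, R ω k) P :=
    (integrable_finsetSum _ fun k _ => iR k).const_mul _
  have jW : Integrable (fun ω => S.γ * (S.N : ℝ)⁻¹ * ∑ k ∈ Finset.range K, W ω k) P :=
    (integrable_finsetSum _ fun k _ => iW k).const_mul _
  have jA : Integrable (fun _ : Ω => A₀) P := integrable_const _
  have jAU : Integrable (fun ω => A₀ + A₁ * ((S.N : ℝ)⁻¹ * ∑ k ∈ Finset.range K, U ω k)) P :=
    jA.add jU
  have jAUR : Integrable (fun ω => A₀ + A₁ * ((S.N : ℝ)⁻¹ * ∑ k ∈ Finset.range K, U ω k) +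
      2 * S.γ * (S.N : ℝ)⁻¹ * ∑ k ∈ Finset.range K, R ω k) P := jAU.add jR
  have hint := integral_mono iGM (jAUR.sub jW) hpath
  have eL : ∫ ω, S.γ * S.τ * ∑ k ∈ Finset.range K, (G ω k + 2 * σg * M ω k) ∂P =
      S.γ * S.τ * ∑ k ∈ Finset.range K, (∫ ω, G ω k ∂P + 2 * σg * ∫ ω, M ω k ∂P) := by
    rw [integral_const_mul, integral_finsetSum _ fun k _ => jGM k]
    congr 1
    refine Finset.sum_congr rfl fun k _ => ?_
    rw [integral_add (iG k) ((iM k).const_mul _), integral_const_mul]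
  have eRHS : ∫ ω, (A₀ + A₁ * ((S.N : ℝ)⁻¹ * ∑ k ∈ Finset.range K, U ω k) +
        2 * S.γ * (S.N : ℝ)⁻¹ * ∑ k ∈ Finset.range K, R ω k -
        S.γ * (S.N : ℝ)⁻¹ * ∑ k ∈ Finset.range K, W ω k) ∂P =
      A₀ + A₁ * (K * (2 * (S.τ : ℝ) ^ 2 * (S.ζ ^ 2 + n * S.σe ^ 2))) +
        2 * S.γ * (S.N : ℝ)⁻¹ * ∑ k ∈ Finset.range K, ∫ ω, R ω k ∂P := by
    rw [integral_sub jAUR jW, integral_add jAU jR, integral_add jA jU, integral_const_mul A₁,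
      integral_const_mul (S.N : ℝ)⁻¹, integral_const_mul (2 * S.γ * (S.N : ℝ)⁻¹),
      integral_const_mul (S.γ * (S.N : ℝ)⁻¹), integral_finsetSum _ fun k _ => iU k,
      integral_finsetSum _ fun k _ => iR k, integral_finsetSum _ fun k _ => iW k,
      Finset.sum_congr rfl fun k _ => eU k, Finset.sum_congr rfl fun k _ => eW k]
    simp only [integral_const, probReal_univ, smul_eq_mul, one_mul, Finset.sum_const,
      Finset.card_range, nsmul_eq_mul, mul_zero, sub_zero]
    field_simp
  have hsumR := Finset.sum_le_sum fun k (_ : k ∈ Finset.range K) => eR k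
  rw [← Finset.mul_sum, ← Finset.mul_sum] at hsumR
  have hR := mul_le_mul_of_nonneg_left hsumR (by positivity : 0 ≤ 2 * S.γ * (S.N : ℝ)⁻¹)
  -- The expected batch error is bounded by exactly the term `2σg ‖∇F‖` kept on the left, so the two
  -- cancel.
  have e2 : 2 * S.γ * (S.N : ℝ)⁻¹ * (S.N * S.τ * (σg * ∑ k ∈ Finset.range K, ∫ ω, M ω k ∂P)) =
      S.γ * S.τ * (2 * σg * ∑ k ∈ Finset.range K, ∫ ω, M ω k ∂P) := by
    field_simp
  rw [e2] at hR
  have hint' := eL.symm.le.trans (hint.trans_eq eRHS)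
  rw [Finset.sum_add_distrib, ← Finset.mul_sum, mul_add] at hint'
  linarith

theorem estimate_of_measurable (hL : 0 < L) (hA : S.Assumptions L σf σg ll lu xstar)
    (hD : S.IsDraw P B e) (hB : ∀ k t i, Measurable (B k t i))
    (he : ∀ k t i, Measurable (e k t i)) {b g : ℝ} (hb : S.β * S.τ * S.ρ = b)
    (hg : S.γ * S.τ ≤ g) {K : ℕ} (hK : 1 ≤ K) :
    S.Estimate P B e σf σg xstar (rateConst n b g L ll lu) K := by
  refine ⟨fun k _ => S.integrable_gap hA hD hB he k, ?_⟩
  have h := S.sum_integral_gap_le hL hA hD hB he K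
  set I := ∑ k ∈ Finset.range K,
    ∫ ω, S.gap σg (S.xbar (fun k t i => B k t i ω) (fun k t i => e k t i ω) k) ∂P
  have hN := hA.N_pos
  have hγ := hA.γ_pos
  have hτ := hA.τ_pos'
  have hρ := hA.ρ_pos
  have hβ := hA.β_pos
  have hll := hA.ll_pos
  have hζ := hA.ζ_pos
  have hσg := hA.σg_pos
  have hK' : (1 : ℝ) ≤ K := by exact_mod_cast hK
  have hb0 : 0 < b := by rw [← hb]; positivity
  have hlu := hA.mul_lu_lt_two
  rw [hb] at h hlu
  have hC := consensusConst_pos (mul_pos hb0 hll) hlu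
  have hd := S.d0NormSq_nonneg
  -- With `b = βτρ` fixed, the factor `(βτ)²` in front of `‖d̂₀‖²` turns into `1/ρ²`.
  have hs : (S.β * S.τ) ^ 2 = b ^ 2 / S.ρ ^ 2 := by
    rw [← hb]; field_simp
  rw [hs] at h
  have hF : 0 ≤ S.F (S.mean S.x0) - S.F xstar := sub_nonneg.mpr (hA.minimizer _)
  obtain ⟨C₁, hC₁⟩ : ∃ C₁, C₁ = 42 + 480 * L ^ 2 * consensusConst (b * ll) (b * lu) * g ^ 2 :=
    ⟨_, rfl⟩
  obtain ⟨C₂, hC₂⟩ : ∃ C₂, C₂ =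
    2160 * L ^ 2 * consensusConst (b * ll) (b * lu) * (1 + 2 / (b * ll)) * b ^ 2 := ⟨_, rfl⟩
  obtain ⟨C₃, hC₃⟩ : ∃ C₃, C₃ =
    (240 * L ^ 2 * (1 + consensusConst (b * ll) (b * lu)) * g + 2 * L) * (n + 1) := ⟨_, rfl⟩
  have hCeq : rateConst n b g L ll lu = 1 + C₁ + C₂ + C₃ := by
    rw [rateConst, hC₁, hC₂, hC₃]
  rw [hCeq]
  set Cc := consensusConst (b * ll) (b * lu)
  have hγτ : 0 < S.γ * S.τ := mul_pos hγ hτ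
  have hg0 : 0 < g := hγτ.trans_le hg
  have p₁ : 0 ≤ C₁ := by rw [hC₁]; positivity
  have p₂ : 0 ≤ C₂ := by rw [hC₂]; positivity
  have p₃ : 0 ≤ C₃ := by rw [hC₃]; positivity
  have t₁ : K * (S.γ * S.τ * (2 * σg * S.ζ + 40 * σf ^ 2)) +
      120 * S.γ * S.τ * L ^ 2 * Cc * (4 * (S.γ * S.τ) ^ 2 * σf ^ 2) ≤
      K * (S.γ * S.τ) * (C₁ * (σf ^ 2 + S.ζ * σg)) := by
    have h1 : (S.γ * S.τ) ^ 2 ≤ g ^ 2 := by gcongr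
    have h2 : 120 * S.γ * S.τ * L ^ 2 * Cc * (4 * (S.γ * S.τ) ^ 2 * σf ^ 2) ≤
        (S.γ * S.τ) * (480 * L ^ 2 * Cc * g ^ 2 * σf ^ 2) := by
      have := mul_le_mul_of_nonneg_left h1
        (by positivity : 0 ≤ (S.γ * S.τ) * (480 * L ^ 2 * Cc * σf ^ 2))
      linarith
    -- The initial gradient shift is paid once over all rounds; `1 ≤ K` lets it join the terms that
    -- occur `K` times.
    have h3 : (S.γ * S.τ) * (480 * L ^ 2 * Cc * g ^ 2 * σf ^ 2) ≤
        K * ((S.γ * S.τ) * (480 * L ^ 2 * Cc * g ^ 2 * σf ^ 2)) :=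
      le_mul_of_one_le_left (by positivity) hK'
    have h4 : 2 * σg * S.ζ + 40 * σf ^ 2 + 480 * L ^ 2 * Cc * g ^ 2 * σf ^ 2 ≤
        C₁ * (σf ^ 2 + S.ζ * σg) := by
      have h5 : 0 ≤ S.ζ * σg := by positivity
      have h6 : 0 ≤ 480 * L ^ 2 * Cc * g ^ 2 * (S.ζ * σg) := by positivity
      rw [hC₁]
      linarith [sq_nonneg σf]
    have h7 := mul_le_mul_of_nonneg_left h4 (by positivity : 0 ≤ K * (S.γ * S.τ))
    linarith
  have t₂ : 120 * S.γ * S.τ * L ^ 2 * Cc *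
      (18 * (1 + 2 / (b * ll)) * (b ^ 2 / S.ρ ^ 2) * (S.d0NormSq / S.N)) =
      K * (S.γ * S.τ) * (C₂ * (S.d0NormSq / (S.ρ ^ 2 * K * S.N))) := by
    rw [hC₂]; field_simp; ring
  have t₃ : (120 * S.γ ^ 3 * S.τ * L ^ 2 * (1 + Cc) + L * S.γ ^ 2) *
      (K * (2 * (S.τ : ℝ) ^ 2 * (S.ζ ^ 2 + n * S.σe ^ 2))) ≤
      K * (S.γ * S.τ) * (C₃ * (S.γ * S.τ * (S.ζ ^ 2 + S.σe ^ 2))) := by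
    have h1 : S.ζ ^ 2 + n * S.σe ^ 2 ≤ (n + 1) * (S.ζ ^ 2 + S.σe ^ 2) := by
      have : 0 ≤ (n : ℝ) * S.ζ ^ 2 := by positivity
      linarith [sq_nonneg S.σe]
    have h2 : 240 * L ^ 2 * (1 + Cc) * (S.γ * S.τ) + 2 * L ≤
        240 * L ^ 2 * (1 + Cc) * g + 2 * L := by gcongr
    have h3 : (240 * L ^ 2 * (1 + Cc) * (S.γ * S.τ) + 2 * L) * (S.ζ ^ 2 + n * S.σe ^ 2) ≤
        (240 * L ^ 2 * (1 + Cc) * g + 2 * L) * ((n + 1) * (S.ζ ^ 2 + S.σe ^ 2)) := by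
      gcongr
    have h4 := mul_le_mul_of_nonneg_left h3 (by positivity : 0 ≤ K * (S.γ * S.τ) ^ 2)
    rw [hC₃]
    linarith
  have t₄ : S.F (S.mean S.x0) - S.F xstar =
      K * (S.γ * S.τ) * ((S.F (S.mean S.x0) - S.F xstar) / (K * S.γ * S.τ)) := by
    field_simp
  have hKγ : 0 < K * (S.γ * S.τ) := by positivity
  have q₁ : 0 ≤ (S.F (S.mean S.x0) - S.F xstar) / (K * S.γ * S.τ) := by positivity
  have q₂ : 0 ≤ S.γ * S.τ * (S.ζ ^ 2 + S.σe ^ 2) := by positivity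
  have q₃ : 0 ≤ σf ^ 2 + S.ζ * σg := by positivity
  have q₄ : 0 ≤ S.d0NormSq / (S.ρ ^ 2 * K * S.N) := by positivity
  rw [t₄] at h
  set Q₁ := (S.F (S.mean S.x0) - S.F xstar) / (K * S.γ * S.τ)
  set Q₂ := S.γ * S.τ * (S.ζ ^ 2 + S.σe ^ 2)
  set Q₃ := σf ^ 2 + S.ζ * σg
  set Q₄ := S.d0NormSq / (S.ρ ^ 2 * K * S.N)
  have hfin : K * (S.γ * S.τ) * (1 / K * I) ≤
      K * (S.γ * S.τ) * (Q₁ + C₃ * Q₂ + C₁ * Q₃ + C₂ * Q₄) := by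
    have e1 : K * (S.γ * S.τ) * (1 / K * I) = S.γ * S.τ * I := by field_simp
    rw [e1]
    linarith
  refine (le_of_mul_le_mul_left hfin hKγ).trans ?_
  have r₁ : 1 * Q₁ ≤ (1 + C₁ + C₂ + C₃) * Q₁ := by gcongr; linarith
  have r₂ : C₃ * Q₂ ≤ (1 + C₁ + C₂ + C₃) * Q₂ := by gcongr; linarith
  have r₃ : C₁ * Q₃ ≤ (1 + C₁ + C₂ + C₃) * Q₃ := by gcongr; linarith
  have r₄ : C₂ * Q₄ ≤ (1 + C₁ + C₂ + C₃) * Q₄ := by gcongr; linarith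
  linarith

/-! ### Passing to measurable versions of the draws -/

theorem localTrain_congr {x : Fin S.N → Vec n} {z : Fin S.N → Fin S.N → Vec n}
    {b b' : ℕ → (i : Fin S.N) → Finset (Fin (S.m i))} {w w' : ℕ → Fin S.N → Vec n} {t : ℕ}
    (hb : ∀ r < t, b r = b' r) (hw : ∀ r < t, w r = w' r) :
    S.localTrain x z b w t = S.localTrain x z b' w' t := by
  induction t with
  | zero => rfl
  | succ t ih =>
    have := ih (fun r hr => hb r (hr.trans t.lt_succ_self))
      (fun r hr => hw r (hr.trans t.lt_succ_self))
    funext i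
    simp only [localTrain, this, hb t t.lt_succ_self, hw t t.lt_succ_self]

theorem state_congr {b b' : ℕ → ℕ → (i : Fin S.N) → Finset (Fin (S.m i))}
    {w w' : ℕ → ℕ → Fin S.N → Vec n} (hb : ∀ k, ∀ t < S.τ, b k t = b' k t)
    (hw : ∀ k, ∀ t < S.τ, w k t = w' k t) (k : ℕ) : S.state b w k = S.state b' w' k := by
  induction k with
  | zero => rfl
  | succ k ih => simp only [state, ih, S.localTrain_congr (hb k) (hw k)]

theorem estimate (hL : 0 < L) (hA : S.Assumptions L σf σg ll lu xstar)
    (hD : S.IsDraw P B e) {b g : ℝ} (hb : S.β * S.τ * S.ρ = b)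
    (hg : S.γ * S.τ ≤ g) {K : ℕ} (hK : 1 ≤ K) :
    S.Estimate P B e σf σg xstar (rateConst n b g L ll lu) K := by
  -- The laws give only a.e. measurable draws for `t < τ`, and nothing for `t ≥ τ`. Measurable
  -- versions are taken in the first case and constants in the second; the trajectory never sees the
  -- latter.
  have hex : ∀ k t i, ∃ (b : Ω → Finset (Fin (S.m i))) (w : Ω → Vec n), Measurable b ∧
      Measurable w ∧ (t < S.τ → B k t i =ᵐ[P] b ∧ e k t i =ᵐ[P] w) := by
    intro k t i
    by_cases ht : t < S.τ
    · have h1 := (hD.batch_law k t ht i).aemeasurable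
      have h2 := (hD.noise_law k t ht i).aemeasurable
      exact ⟨h1.mk, h2.mk, h1.measurable_mk, h2.measurable_mk, fun _ => ⟨h1.ae_eq_mk, h2.ae_eq_mk⟩⟩
    · exact ⟨fun _ => ∅, fun _ => 0, measurable_const, measurable_const, fun h => absurd h ht⟩
  choose B' e' hB' he' hae using hex
  have hD' : S.IsDraw P B' e' :=
    { batch_law := fun k t ht i => (hD.batch_law k t ht i).congr (hae k t i ht).1.symm
      noise_law := fun k t ht i => (hD.noise_law k t ht i).congr (hae k t i ht).2.symm
      indep_batch_noise := fun k t ht i =>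
        (hD.indep_batch_noise k t ht i).congr (hae k t i ht).1 (hae k t i ht).2
      indep := hD.indep.congr fun p =>
        (hae p.1 p.2.1 p.2.2 p.2.1.isLt).1.prodMk (hae p.1 p.2.1 p.2.2 p.2.1.isLt).2 }
  have hall : ∀ᵐ ω ∂P, ∀ k t i, t < S.τ → B k t i ω = B' k t i ω ∧ e k t i ω = e' k t i ω := by
    simp only [ae_all_iff]
    intro k t i ht
    filter_upwards [(hae k t i ht).1, (hae k t i ht).2] with ω h1 h2 using ⟨h1, h2⟩
  have hgap : ∀ k, (fun ω => S.gap σg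
      (S.xbar (fun k t i => B' k t i ω) (fun k t i => e' k t i ω) k)) =ᵐ[P]
      fun ω => S.gap σg (S.xbar (fun k t i => B k t i ω) (fun k t i => e k t i ω) k) := by
    intro k
    filter_upwards [hall] with ω hω
    rw [xbar, xbar, S.state_congr (fun k t ht => funext fun i => (hω k t i ht).1)
      (fun k t ht => funext fun i => (hω k t i ht).2)]
  obtain ⟨h1, h2⟩ := S.estimate_of_measurable hL hA hD' hB' he' hb hg hK
  refine ⟨fun k hk => (h1 k hk).congr (hgap k), ?_⟩
  rwa [Finset.sum_congr rfl fun k _ => integral_congr_ae (hgap k)] at h2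

end Expectation

/-! ### Monotonicity in the constant and bounds on the step size -/

theorem Estimate.mono {Ω : Type*} [MeasurableSpace Ω] {P : Measure Ω}
    {B : ℕ → ℕ → (i : Fin S.N) → Ω → Finset (Fin (S.m i))} {e : ℕ → ℕ → Fin S.N → Ω → Vec n}
    (hA : S.Assumptions L σf σg ll lu xstar) {K : ℕ} {C C' : ℝ}
    (h : S.Estimate P B e σf σg xstar C K) (hC : C ≤ C') :
    S.Estimate P B e σf σg xstar C' K := by
  refine ⟨h.1, h.2.trans ?_⟩
  have hγ := hA.γ_pos
  have hζ := hA.ζ_pos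
  have hσg := hA.σg_pos
  have hd := S.d0NormSq_nonneg
  have hF : 0 ≤ S.F (S.mean S.x0) - S.F xstar := sub_nonneg.mpr (hA.minimizer _)
  gcongr

theorem γ_mul_τ_le (hL : 0 < L) (hA : S.Assumptions L σf σg ll lu xstar) {c : ℝ} (hc : 0 < c)
    (h : S.γ ≤ c * (ll / (L * (S.τ : ℝ) ^ 2))) : S.γ * S.τ ≤ c * ll / L := by
  have hτ := hA.τ_pos'
  have hll := hA.ll_pos
  have h1 : (1 : ℝ) ≤ S.τ := by exact_mod_cast hA.τ_pos
  calc S.γ * S.τ ≤ c * (ll / (L * (S.τ : ℝ) ^ 2)) * S.τ := by gcongr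
    _ = c * ll / L / S.τ := by field_simp
    _ ≤ c * ll / L := div_le_self (by positivity) h1

theorem DetailedStepBound.γ_mul_le (hL : 0 < L) (hA : S.Assumptions L σf σg ll lu xstar)
    (h : S.DetailedStepBound L ll) : S.γ * L ≤ 1 := by
  have hN := hA.N_pos
  have hγ := hA.γ_pos
  have hτ := hA.τ_pos'
  have hρ := hA.ρ_pos
  have hβ := hA.β_pos
  have hll := hA.ll_pos
  simp only [DetailedStepBound] at h
  have h1 : 0 ≤ 8 * L ^ 2 / S.N * (54 * S.β / (ll * S.ρ) + 108 * S.τ * S.β ^ 2) *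
      ((1 + 2 * S.ρ ^ 2 * ‖Matrix.toEuclideanCLM (𝕜 := ℝ) (S.G.lapMatrix ℝ)‖ ^ 2) *
      (4 * (S.τ : ℝ) ^ 2 * S.N) * ‖Matrix.toEuclideanCLM (𝕜 := ℂ) S.V⁻¹‖ * S.γ ^ 2 /
        (1 - (1 - ll * S.ρ * S.τ * S.β / 2)) ^ 2) := by positivity
  have h2 : 8 * L ^ 2 / S.N * S.γ ^ 2 * (12 * S.τ * S.N + 24 * S.N) =
      (S.γ * L) ^ 2 * (96 * S.τ + 192) := by field_simp; ring
  rw [h2] at h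
  have h3 : 0 ≤ (S.γ * L) ^ 2 * (96 * S.τ) := by positivity
  nlinarith [mul_pos hγ hL]

end

end LTADMMDP

end

/-- Both parts specialise the same estimate: the first with `g = c λ_l / L`, the second with `g = T
/ L`, where `T` bounds `τ`. -/
theorem theorem1 (n : ℕ) (L ll lu : ℝ) (hL : 0 < L) :
    (∀ b c : ℝ, 0 < b → 0 < c → ∃ C : ℝ, 0 < C ∧
      ∀ (S : LTADMMDP n) (σf σg : ℝ) (xstar : Vec n), S.Assumptions L σf σg ll lu xstar →
        S.β * S.τ * S.ρ = b →
        S.γ ≤ c * (ll / (L * (S.τ : ℝ) ^ 2)) →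
        ∀ (Ω : Type*) (_ : MeasurableSpace Ω) (P : MeasureTheory.Measure Ω)
          (_ : MeasureTheory.IsProbabilityMeasure P)
          (B : ℕ → ℕ → (i : Fin S.N) → Ω → Finset (Fin (S.m i)))
          (e : ℕ → ℕ → Fin S.N → Ω → Vec n), S.IsDraw P B e →
          ∀ K : ℕ, 1 ≤ K → S.Estimate P B e σf σg xstar C K) ∧
    (∀ β ρ : ℝ, 0 < β → 0 < ρ → ∃ C : ℝ, 0 < C ∧
      ∀ (S : LTADMMDP n) (σf σg : ℝ) (xstar : Vec n), S.Assumptions L σf σg ll lu xstar →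
        S.β = β → S.ρ = ρ →
        S.DetailedStepBound L ll →
        ∀ (Ω : Type*) (_ : MeasurableSpace Ω) (P : MeasureTheory.Measure Ω)
          (_ : MeasureTheory.IsProbabilityMeasure P)
          (B : ℕ → ℕ → (i : Fin S.N) → Ω → Finset (Fin (S.m i)))
          (e : ℕ → ℕ → Fin S.N → Ω → Vec n), S.IsDraw P B e →
          ∀ K : ℕ, 1 ≤ K → S.Estimate P B e σf σg xstar C K) := by
  constructor
  · intro b c hb hc
    -- If this fails, no run satisfies the assumptions with the given `b`, and any positive constant
    -- will do.
    by_cases h : 0 < ll ∧ b * lu < 2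
    · refine ⟨LTADMMDP.rateConst n b (c * ll / L) L ll lu,
        LTADMMDP.rateConst_pos hb (by have := h.1; positivity) hL h.1 h.2, ?_⟩
      intro S σf σg xstar hA hSb hγ Ω _ P _ B e hD K hK
      exact S.estimate hL hA hD hSb (S.γ_mul_τ_le hL hA hc hγ) hK
    · refine ⟨1, one_pos, fun S σf σg xstar hA hSb => absurd ⟨hA.ll_pos, ?_⟩ h⟩
      rw [← hSb]
      exact hA.mul_lu_lt_two
  · intro β ρ hβ hρ
    -- `τ < 2 / (lu ρ β)`, so only finitely many constants of the first part are needed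
    let T : ℕ := ⌈2 / (lu * ρ * β)⌉₊
    -- For some `t ≤ T`, such as `t = 0`, no run exists and the sign of `rateConst` is not
    -- controlled. The maximum with `1` keeps every summand nonnegative, so the sum dominates the
    -- term at `τ`.
    let c : ℕ → ℝ := fun t => max 1 (LTADMMDP.rateConst n (β * t * ρ) (T / L) L ll lu)
    have hc : ∀ t, 0 ≤ c t := fun t => zero_le_one.trans (le_max_left _ _)
    refine ⟨1 + ∑ t ∈ Finset.range (T + 1), c t,
      add_pos_of_pos_of_nonneg one_pos (Finset.sum_nonneg fun t _ => hc t), ?_⟩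
    intro S σf σg xstar hA hSβ hSρ hstep Ω _ P _ B e hD K hK
    have hlu := hA.lu_pos
    have hγ := hA.γ_pos
    have hτT : S.τ ≤ T := by
      have h1 : (S.τ : ℝ) ≤ 2 / (lu * ρ * β) := by
        rw [le_div_iff₀ (by positivity), ← hSβ, ← hSρ]
        linarith [hA.mul_lu_lt_two]
      exact_mod_cast h1.trans (Nat.le_ceil _)
    have hγT : S.γ * S.τ ≤ T / L := by
      rw [le_div_iff₀ hL]
      have h1 := LTADMMDP.DetailedStepBound.γ_mul_le S hL hA hstep
      have h2 : (S.τ : ℝ) ≤ T := by exact_mod_cast hτT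
      have h3 : S.γ * L * S.τ ≤ 1 * T := by gcongr
      linarith
    have hest := S.estimate hL hA hD (b := β * S.τ * ρ) (by rw [hSβ, hSρ]) hγT hK
    refine hest.mono S hA ?_
    have h1 : c S.τ ≤ ∑ t ∈ Finset.range (T + 1), c t :=
      Finset.single_le_sum (fun t _ => hc t) (Finset.mem_range.mpr (Nat.lt_succ_of_le hτT))
    have h2 : LTADMMDP.rateConst n (β * S.τ * ρ) (T / L) L ll lu ≤ c S.τ := le_max_right _ _
    linarith
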